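/- **Theorem 3 (Offord's large-deviation estimate).** Let $G\subseteq\mathbb C$ be a domain (a non-empty connected open set), let $N\in\{1,2,\dots\}\cup\{\infty\}$, and let $(\psi_j)_{1\le j\le N}$ be analytic functions in $G$, not all identically zero; if $N=\infty$, assume that $\sum_j|\psi_j(z)|^2$ converges locally uniformly in $G$. Let $\omega_j$, $1\le j\le N$, be independent standard complex Gaussian random variables on a probability space (rotation-invariant Gaussian law, $\mathcal E\{\omega_j\}=0$, $\mathcal E\{|\omega_j|^2\}=1$). Put $\psi(z,\omega)=\sum_j\omega_j\psi_j(z)$ (a series which almost surely converges locally uniformly in $G$), let $n_\omega$ be the counting measure of the zeros of $\psi(\cdot,\omega)$ in $G$, counted with multiplicity, and let $\mathcal E\{n_\omega\}$ be its mean, the measure $B\mapsto\mathcal E\{n_\omega(B)\}$. Let $\phi$ be a (real- or complex-valued) $C^\infty$ function with compact support contained in $G$. Then $\phi$ is integrable with respect to $\mathcal E\{n_\omega\}$ and, almost surely, with respect to $n_\omega$, and for every $\lambda>0$ $$\Pr\Big(\Big|\int_G\phi\,(dn_\omega-\mathcal E\{dn_\omega\})\Big|\ge\lambda\Big)\le 3\exp\Big(-\frac{2\pi\lambda}{\|\Delta\phi\|_{L^1}}\Big),$$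 where $\Delta$ is the Laplacian and the $L^1$ norm is taken with respect to plane Lebesgue measure. (If $\phi\equiv0$, the left-hand side is $0$ and there is nothing to prove.) -/

import Mathlib

open MeasureTheory ProbabilityTheory Filter Topology
open scoped ENNReal Laplacian

noncomputable section

/-- The standard complex Gaussian law: independent real and imaginary parts, both centred of
variance `1/2`, so that the mean is `0` and the mean of `|z|^2` is `1`. -/
def stdComplexGaussian : Measure ℂ :=
  ((gaussianReal 0 (1 / 2)).prod (gaussianReal 0 (1 / 2))).map Complex.measurableEquivRealProd.symm

open Classical in
/-- The sum of the terms `ξ j ω * ψ j z` over the first `n` indices `j < N`, where `N ≤ ∞`.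
Entries of `ψ` and `ξ` with index `j ≥ N` are never used. -/
def gafPartialSum {Ω : Type*} (N : ℕ∞) (ψ : ℕ → ℂ → ℂ) (ξ : ℕ → Ω → ℂ) (n : ℕ) (ω : Ω) (z : ℂ) : ℂ :=
  ∑ j ∈ (Finset.range n).filter (fun j : ℕ => (j : ℕ∞) < N), ξ j ω * ψ j z

/-- The Gaussian analytic function `∑_{j < N} ξ j ω * ψ j z`, as the limit of its partial sums. -/
def gaf {Ω : Type*} (N : ℕ∞) (ψ : ℕ → ℂ → ℂ) (ξ : ℕ → Ω → ℂ) (ω : Ω) (z : ℂ) : ℂ :=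
  limUnder atTop fun n : ℕ => gafPartialSum N ψ ξ n ω z

/-- The counting measure of the zeros in `G` of a function `f` (analytic in `G`): each zero carries
a point mass equal to its multiplicity. -/
def zeroMeasure (G : Set ℂ) (f : ℂ → ℂ) : Measure ℂ :=
  Measure.sum fun z : G => ((analyticOrderAt f (z : ℂ) : ℕ∞) : ℝ≥0∞) • Measure.dirac (z : ℂ)

/-- The counting measure `n_ω` of the zeros of the Gaussian analytic function in `G`. -/
def gafZeros {Ω : Type*} (G : Set ℂ) (N : ℕ∞) (ψ : ℕ → ℂ → ℂ) (ξ : ℕ → Ω → ℂ) (ω : Ω) :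
    Measure ℂ :=
  zeroMeasure G (gaf N ψ ξ ω)

/-- The mean of a random measure: `B ↦ ∫⁻ ω, n ω B ∂P` (meaningful when `n` is a.e. measurable). -/
def meanMeasure {Ω : Type*} [MeasurableSpace Ω] (P : Measure Ω) (n : Ω → Measure ℂ) : Measure ℂ :=
  P.bind n

end

/-! Write V = ∑|ψ_j|² and L = log(|ψ|/√V), so that log|ψ| = L + ½ log V almost everywhere in G.
Green's formula gives 2π∫φ dn_ω = ∫ log|ψ| Δφ. At each z with V(z) > 0 the ratio ψ(z)/√V(z) is a
standard complex Gaussian ζ, so the mean of L(z) does not depend on z and drops out because ∫Δφ = 0.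
Hence 2π∫φ dn_ω has mean ½∫ log V Δφ, and the fluctuation of ∫φ dn_ω is (2π)⁻¹∫ L Δφ.

If the fluctuation is at least λ in modulus, the average of |L| against the probability density
|Δφ|/‖Δφ‖₁ is at least a = 2πλ/‖Δφ‖₁, so by Jensen the average of e^|L| is at least e^a. Markov,
Tonelli and E e^|log|ζ|| ≤ E|ζ| + E|ζ|⁻¹ = (3/2)√π ≤ 3 give the bound 3e^(-a). Only the law of ψ at
single points enters. This is `IsGaussianAnalyticFunction.measureReal_le_norm_sub_le`.

The rest justifies the setting. Green's formula (`integrable_and_integral_log_norm_smul_laplacian`)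
comes from the fundamental solution log|z - a|, and it also yields the measurability of the zeros
(`measurable_zeroMeasure`). Almost sure locally uniform convergence (`ae_tendstoLocallyUniformlyOn`)
comes from Kolmogorov's maximal inequality in L² of circles and Cauchy's formula. A version of ψ
that behaves well for every ω is built in `exists_isGaussianAnalyticFunction`. -/

/-! ### Test functions and Green's second identity. -/

section Laplacian

variable {E : Type*} [NormedAddCommGroup E] [NormedSpace ℝ E]

lemma ContDiff.continuous_laplacian {φ : ℂ → E} (hφ : ContDiff ℝ 2 φ) : Continuous (Δ φ) := by
  rw [InnerProductSpace.laplacian_eq_iteratedFDeriv_complexPlane]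
  have h := hφ.continuous_iteratedFDeriv (m := 2) le_rfl
  fun_prop

lemma tsupport_laplacian_subset (φ : ℂ → E) : tsupport (Δ φ) ⊆ tsupport φ := by
  refine closure_minimal (fun z hz => ?_) (isClosed_tsupport φ)
  by_contra h
  refine hz ?_
  have h0 : φ =ᶠ[𝓝 z] fun _ => (0 : E) := notMem_tsupport_iff_eventuallyEq.mp h
  rw [InnerProductSpace.laplacian_congr_nhds h0 |>.eq_of_nhds]
  simp

lemma HasCompactSupport.laplacian {φ : ℂ → E} (hφ : HasCompactSupport φ) :
    HasCompactSupport (Δ φ) :=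
  hφ.of_isClosed_subset (isClosed_tsupport _) (tsupport_laplacian_subset φ)

/-- A smooth cut-off function between a compact set and an open set of the plane. -/
lemma exists_cutoff {K U : Set ℂ} (hK : IsCompact K) (hU : IsOpen U) (hKU : K ⊆ U) :
    ∃ χ : ℂ → ℝ, ContDiff ℝ (⊤ : ℕ∞) χ ∧ HasCompactSupport χ ∧ tsupport χ ⊆ U ∧
      (∀ᶠ z in 𝓝ˢ K, χ z = 1) ∧ ∀ z, χ z ∈ Set.Icc (0 : ℝ) 1 := by
  obtain ⟨L, hL, hKL, hLU⟩ := exists_compact_between hK hU hKU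
  obtain ⟨f, h1, h0, h01⟩ := exists_contMDiffMap_one_nhds_of_subset_interior
    (n := ⊤) (modelWithCornersSelf ℝ ℂ) hK.isClosed hKL
  have hsub : tsupport (f : ℂ → ℝ) ⊆ L :=
    closure_minimal (fun z hz => by by_contra h; exact hz (h0 z h)) hL.isClosed
  exact ⟨f, f.contMDiff.contDiff, hL.of_isClosed_subset (isClosed_tsupport _) hsub,
    hsub.trans hLU, h1, h01⟩

lemma integral_smul_laplacian_of_hasCompactSupport {u : ℂ → ℝ} {φ : ℂ → E}
    (hu : ContDiff ℝ (⊤ : ℕ∞) u) (huc : HasCompactSupport u)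
    (hφ : ContDiff ℝ (⊤ : ℕ∞) φ) (hφc : HasCompactSupport φ) :
    ∫ z, u z • Δ φ z = ∫ z, Δ u z • φ z := by
  have := SchwartzMap.integral_smul_laplacian_right_eq_left (μ := (volume : Measure ℂ))
    (huc.toSchwartzMap hu) (hφc.toSchwartzMap hφ)
  simp only [SchwartzMap.laplacian_apply] at this
  exact this

/-- Green's second identity, for a function analytic near the support of the test function. -/
lemma integral_smul_laplacian_of_analyticAt {u : ℂ → ℝ} {φ : ℂ → E}
    (hφ : ContDiff ℝ (⊤ : ℕ∞) φ) (hφc : HasCompactSupport φ)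
    (hu : ∀ z ∈ tsupport φ, AnalyticAt ℝ u z) :
    ∫ z, u z • Δ φ z = ∫ z, Δ u z • φ z := by
  -- Nothing is known of u away from the support of φ; χu is smooth everywhere and agrees with u
  -- near that support, so neither integral changes.
  obtain ⟨χ, hχ, hχc, hχU, h1, -⟩ := exists_cutoff hφc (isOpen_analyticAt ℝ u) hu
  have hs : ContDiff ℝ (⊤ : ℕ∞) (fun z => χ z * u z) := by
    rw [contDiff_iff_contDiffAt]
    intro z
    by_cases hz : z ∈ tsupport χ
    · exact hχ.contDiffAt.mul (hχU hz).contDiffAt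
    · refine contDiffAt_const (c := (0 : ℝ)) |>.congr_of_eventuallyEq ?_
      filter_upwards [notMem_tsupport_iff_eventuallyEq.mp hz] with w hw
      simp [hw]
  have key := integral_smul_laplacian_of_hasCompactSupport hs hχc.mul_right hφ hφc
  rw [eventually_nhdsSet_iff_forall] at h1
  have e1 : ∀ z, (χ z * u z) • Δ φ z = u z • Δ φ z := by
    intro z
    by_cases hz : z ∈ tsupport φ
    · rw [(h1 z hz).self_of_nhds, one_mul]
    · rw [image_eq_zero_of_notMem_tsupport (fun h => hz (tsupport_laplacian_subset φ h))]
      simp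
  have e2 : ∀ z, Δ (fun z => χ z * u z) z • φ z = Δ u z • φ z := by
    intro z
    by_cases hz : z ∈ tsupport φ
    · have : (fun z => χ z * u z) =ᶠ[𝓝 z] u := by
        filter_upwards [h1 z hz] with w hw
        rw [hw, one_mul]
      rw [(InnerProductSpace.laplacian_congr_nhds this).eq_of_nhds]
    · rw [image_eq_zero_of_notMem_tsupport hz]
      simp
  simpa only [e1, e2] using key

end Laplacian

/-! ### The logarithmic potential as fundamental solution. -/

section LogPotential

/-- log = log⁺|z| - log⁺(1/|z|): the first term is continuous and the second is at most |z|⁻¹,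
locally integrable in dimension 2. -/
lemma locallyIntegrable_log_norm : LocallyIntegrable (fun z : ℂ => Real.log ‖z‖) := by
  have h1 : LocallyIntegrable (fun z : ℂ => Real.posLog ‖z‖⁻¹) := by
    refine locallyIntegrable_of_norm_le_rpow (by simp) (C := 1) (α := 1) (by simp) ?_
      (by fun_prop)
    refine Eventually.of_forall fun z => ?_
    rw [Real.norm_of_nonneg Real.posLog_nonneg, one_mul, Real.rpow_neg_one]
    rw [Real.posLog_def]
    exact max_le (by positivity) ((Real.log_le_self (by positivity)))
  have h2 : LocallyIntegrable (fun z : ℂ => Real.posLog ‖z‖) := by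
    refine Continuous.locallyIntegrable ?_
    exact Real.continuous_posLog.comp continuous_norm
  refine (h2.sub h1).congr (Eventually.of_forall fun z => ?_)
  simpa using Real.posLog_sub_posLog_inv (x := ‖z‖)

lemma locallyIntegrable_log_norm_sub (a : ℂ) :
    LocallyIntegrable (fun z : ℂ => Real.log ‖z - a‖) := by
  intro z
  obtain ⟨s, hs, h⟩ := locallyIntegrable_log_norm (z - a)
  refine ⟨(fun w => w - a) ⁻¹' s, (continuous_id.sub continuous_const).continuousAt hs, ?_⟩
  exact ((measurePreserving_sub_right volume a).integrableOn_comp_preimage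
    (Homeomorph.subRight a).measurableEmbedding).2 h

lemma hasDerivAt_half_log_quadratic (A b c t : ℝ) (h : ∀ t, 0 < A + b * t + c * t ^ 2) :
    HasDerivAt (fun t => 1 / 2 * Real.log (A + b * t + c * t ^ 2))
      (1 / 2 * ((b + 2 * c * t) / (A + b * t + c * t ^ 2))) t := by
  have : HasDerivAt (fun t => A + b * t + c * t ^ 2) (b + 2 * c * t) t := by
    refine ((((hasDerivAt_id t).const_mul b).const_add A).add
      (((hasDerivAt_id t).pow 2).const_mul c)).congr_deriv ?_
    simp; ring
  exact (this.log (h t).ne').const_mul _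

/-- Second directional derivatives are iterated derivatives along lines. -/
lemma iteratedFDeriv_two_eq_deriv_deriv {u : ℂ → ℝ} (hu : ContDiff ℝ 2 u) (z v : ℂ) :
    iteratedFDeriv ℝ 2 u z ![v, v] = deriv (deriv fun t : ℝ => u (z + t • v)) 0 := by
  have hline : ∀ t : ℝ, HasDerivAt (fun t : ℝ => z + t • v) v t := fun t => by
    simpa using ((hasDerivAt_id t).smul_const v).const_add z
  have h1 : (deriv fun t : ℝ => u (z + t • v)) = fun t => fderiv ℝ u (z + t • v) v := by
    funext t
    exact ((hu.differentiable (by simp) (z + t • v)).hasFDerivAt.comp_hasDerivAt t (hline t)).deriv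
  rw [h1, iteratedFDeriv_two_apply]
  have h2 : DifferentiableAt ℝ (fderiv ℝ u) (z + (0 : ℝ) • v) :=
    (hu.fderiv_right (m := 1) (by norm_num)).differentiable (by simp) _
  have h3 := (h2.hasFDerivAt.comp_hasDerivAt (0 : ℝ) (hline 0))
  have h4 := ((ContinuousLinearMap.apply ℝ ℝ v).hasFDerivAt.comp_hasDerivAt (0 : ℝ) h3)
  have h5 := h4.deriv
  simp only [zero_smul, add_zero] at h5
  simpa [Function.comp_def] using h5.symm

lemma analyticAt_half_log_sq {ε : ℝ} (hε : 0 < ε) (z : ℂ) :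
    AnalyticAt ℝ (fun z : ℂ => 1 / 2 * Real.log (‖z‖ ^ 2 + ε ^ 2)) z := by
  have h : AnalyticAt ℝ (fun z : ℂ => ‖z‖ ^ 2 + ε ^ 2) z := by
    have : (fun z : ℂ => ‖z‖ ^ 2 + ε ^ 2) =
        fun z => Complex.reCLM z * Complex.reCLM z + Complex.imCLM z * Complex.imCLM z + ε ^ 2 := by
      funext z
      rw [← Complex.normSq_eq_norm_sq, Complex.normSq_apply]
      simp
    rw [this]
    have h1 := Complex.reCLM.analyticAt z
    have h2 := Complex.imCLM.analyticAt z
    exact ((h1.mul h1).add (h2.mul h2)).add analyticAt_const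
  exact analyticAt_const.mul ((analyticAt_log (by positivity)).comp h)

/-- These functions smooth log|z|, and their Laplacians form an approximate identity of mass 2π.
Along the directions 1 and i the argument of the logarithm is quadratic in t with linear
coefficients 2 Re z and 2 Im z; adding the two second derivatives cancels |z|² and leaves 2ε². -/
lemma laplacian_half_log_sq {ε : ℝ} (hε : 0 < ε) (z : ℂ) :
    Δ (fun z : ℂ => 1 / 2 * Real.log (‖z‖ ^ 2 + ε ^ 2)) z =
      2 * ε ^ 2 / (‖z‖ ^ 2 + ε ^ 2) ^ 2 := by
  have hs : ContDiff ℝ 2 (fun z : ℂ => 1 / 2 * Real.log (‖z‖ ^ 2 + ε ^ 2)) :=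
    contDiff_iff_contDiffAt.2 fun z => (analyticAt_half_log_sq hε z).contDiffAt
  rw [InnerProductSpace.laplacian_eq_iteratedFDeriv_complexPlane]
  beta_reduce
  rw [iteratedFDeriv_two_eq_deriv_deriv hs, iteratedFDeriv_two_eq_deriv_deriv hs]
  have key : ∀ b : ℝ, (∀ t : ℝ, 0 < (‖z‖ ^ 2 + ε ^ 2) + b * t + 1 * t ^ 2) →
      deriv (deriv fun t : ℝ => 1 / 2 * Real.log ((‖z‖ ^ 2 + ε ^ 2) + b * t + 1 * t ^ 2)) 0 =
        (‖z‖ ^ 2 + ε ^ 2 - b ^ 2 / 2) / (‖z‖ ^ 2 + ε ^ 2) ^ 2 := by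
    intro b hb
    have e1 : (deriv fun t : ℝ => 1 / 2 * Real.log ((‖z‖ ^ 2 + ε ^ 2) + b * t + 1 * t ^ 2)) =
      fun t => 1 / 2 * ((b + 2 * 1 * t) / ((‖z‖ ^ 2 + ε ^ 2) + b * t + 1 * t ^ 2)) :=
        funext fun t => (hasDerivAt_half_log_quadratic _ b 1 t hb).deriv
    rw [e1]
    have hq : HasDerivAt (fun t => (‖z‖ ^ 2 + ε ^ 2) + b * t + 1 * t ^ 2) b 0 := by
      refine ((((hasDerivAt_id (0 : ℝ)).const_mul b).const_add (‖z‖ ^ 2 + ε ^ 2)).add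
        (((hasDerivAt_id (0 : ℝ)).pow 2).const_mul 1)).congr_deriv ?_
      simp
    have hn : HasDerivAt (fun t : ℝ => b + 2 * 1 * t) 2 0 := by
      refine (((hasDerivAt_id (0 : ℝ)).const_mul (2 * 1)).const_add b).congr_deriv ?_
      simp
    have hd : HasDerivAt (fun t => 1 / 2 * ((b + 2 * 1 * t) / ((‖z‖ ^ 2 + ε ^ 2) + b * t + 1 * t ^ 2)))
      _ 0 := (hn.div hq (hb 0).ne').const_mul (1 / 2)
    rw [hd.deriv]
    have : (0 : ℝ) < ‖z‖ ^ 2 + ε ^ 2 := by positivity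
    simp
    field_simp
  have hn1 : ∀ t : ℝ, ‖z + t • (1 : ℂ)‖ ^ 2 + ε ^ 2
      = (‖z‖ ^ 2 + ε ^ 2) + (2 * z.re) * t + 1 * t ^ 2 := by
    intro t
    rw [← Complex.normSq_eq_norm_sq, ← Complex.normSq_eq_norm_sq, Complex.normSq_apply,
      Complex.normSq_apply]
    simp
    ring
  have hn2 : ∀ t : ℝ, ‖z + t • Complex.I‖ ^ 2 + ε ^ 2
      = (‖z‖ ^ 2 + ε ^ 2) + (2 * z.im) * t + 1 * t ^ 2 := by
    intro t
    rw [← Complex.normSq_eq_norm_sq, ← Complex.normSq_eq_norm_sq, Complex.normSq_apply,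
      Complex.normSq_apply]
    simp
    ring
  simp only [hn1, hn2]
  rw [key _ (fun t => by rw [← hn1]; positivity), key _ (fun t => by rw [← hn2]; positivity),
    ← add_div]
  congr 1
  have : ‖z‖ ^ 2 = z.re * z.re + z.im * z.im := by
    rw [← Complex.normSq_eq_norm_sq, Complex.normSq_apply]
  rw [this]; ring

lemma integral_two_div_one_add_norm_sq_sq :
    ∫ z : ℂ, 2 / (‖z‖ ^ 2 + 1) ^ 2 = 2 * Real.pi := by
  rw [← Complex.integral_comp_polarCoord_symm, polarCoord_target, Measure.volume_eq_prod]
  have h1 : ∀ p : ℝ × ℝ, p.1 • (2 / (‖Complex.polarCoord.symm p‖ ^ 2 + 1) ^ 2) =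
      (2 * p.1 / (p.1 ^ 2 + 1) ^ 2) * 1 := by
    intro p
    rw [Complex.norm_polarCoord_symm, sq_abs, smul_eq_mul]
    ring
  simp_rw [h1]
  rw [setIntegral_prod_mul (fun r : ℝ => 2 * r / (r ^ 2 + 1) ^ 2) (fun _ => (1 : ℝ))]
  have hd : ∀ r ∈ Set.Ioi (0 : ℝ), HasDerivAt (fun r : ℝ => -(r ^ 2 + 1)⁻¹)
      (2 * r / (r ^ 2 + 1) ^ 2) r := by
    intro r _
    have h : HasDerivAt (fun r : ℝ => r ^ 2 + 1) (2 * r) r := by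
      simpa using (hasDerivAt_pow 2 r).add_const 1
    refine (h.inv (by positivity)).neg.congr_deriv ?_
    ring
  have hc : ContinuousWithinAt (fun r : ℝ => -(r ^ 2 + 1)⁻¹) (Set.Ici 0) 0 := by
    refine ContinuousAt.continuousWithinAt ?_
    exact ((by fun_prop : ContinuousAt (fun r : ℝ => r ^ 2 + 1) 0).inv₀ (by simp)).neg
  have ht : Tendsto (fun r : ℝ => -(r ^ 2 + 1)⁻¹) atTop (𝓝 0) := by
    rw [← neg_zero]
    refine (tendsto_inv_atTop_zero.comp ?_).neg
    exact tendsto_atTop_add_const_right _ _ (tendsto_pow_atTop two_ne_zero)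
  rw [integral_Ioi_of_hasDerivAt_of_nonneg hc hd (fun r hr => ?_) ht]
  · simp only [integral_const, measureReal_restrict_apply_univ, Real.volume_real_Ioo_of_le
      (neg_le_self Real.pi_pos.le), smul_eq_mul]
    norm_num
    ring
  · have : (0 : ℝ) < r := hr
    positivity

lemma integrable_two_div_one_add_norm_sq_sq :
    Integrable fun z : ℂ => 2 / (‖z‖ ^ 2 + 1) ^ 2 := by
  by_contra h
  -- A non-integrable function has integral 0 by convention, which contradicts the value 2π.
  have := integral_two_div_one_add_norm_sq_sq
  rw [integral_undef h] at this
  linarith [Real.pi_pos]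

variable {E : Type*} [NormedAddCommGroup E] [NormedSpace ℝ E]

lemma MeasureTheory.LocallyIntegrable.integrable_smul_laplacian {u : ℂ → ℝ} (hu : LocallyIntegrable u)
    {φ : ℂ → E} (hφ : ContDiff ℝ 2 φ) (hφc : HasCompactSupport φ) :
    Integrable fun z => u z • Δ φ z :=
  hu.integrable_smul_right_of_hasCompactSupport hφ.continuous_laplacian hφc.laplacian

lemma tendsto_integral_half_log_sq {φ : ℂ → E}
    (hφ : ContDiff ℝ 2 φ) (hφc : HasCompactSupport φ) :
    Tendsto (fun ε : ℝ => ∫ z, (1 / 2 * Real.log (‖z‖ ^ 2 + ε ^ 2)) • Δ φ z) (𝓝[>] 0)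
      (𝓝 (∫ z, Real.log ‖z‖ • Δ φ z)) := by
  have hb : LocallyIntegrable fun z : ℂ => |Real.log ‖z‖| + ‖z‖ ^ 2 :=
    LocallyIntegrable.add (fun z => (locallyIntegrable_log_norm z).imp fun _ h => ⟨h.1, h.2.abs⟩) (by fun_prop : Continuous fun z : ℂ => ‖z‖ ^ 2).locallyIntegrable
  refine tendsto_integral_filter_of_dominated_convergence
    (fun z => ‖(|Real.log ‖z‖| + ‖z‖ ^ 2) • Δ φ z‖) ?_ ?_
    (MeasureTheory.LocallyIntegrable.integrable_smul_laplacian hb hφ hφc).norm ?_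
  · refine Eventually.of_forall fun ε => ?_
    refine AEStronglyMeasurable.smul ?_ hφ.continuous_laplacian.aestronglyMeasurable
    exact (by fun_prop : Measurable fun z : ℂ => 1 / 2 * Real.log (‖z‖ ^ 2 + ε ^ 2)).aestronglyMeasurable
  -- For 0 < ε < 1: log|z| ≤ ½ log(|z|² + ε²) ≤ ½(|z|² + ε² - 1) ≤ ½|z|².
  · filter_upwards [Ioo_mem_nhdsGT (zero_lt_one' ℝ)] with ε hε
    have h0 : ∀ᵐ z : ℂ, z ≠ 0 := Measure.ae_ne volume 0
    filter_upwards [h0] with z hz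
    have hz' : 0 < ‖z‖ := norm_pos_iff.2 hz
    rw [norm_smul, norm_smul]
    gcongr
    rw [Real.norm_eq_abs, Real.norm_of_nonneg (by positivity), abs_le]
    have h1 : Real.log ‖z‖ ≤ 1 / 2 * Real.log (‖z‖ ^ 2 + ε ^ 2) := by
      have : Real.log (‖z‖ ^ 2) ≤ Real.log (‖z‖ ^ 2 + ε ^ 2) :=
        Real.log_le_log (by positivity) (by nlinarith [sq_nonneg ε])
      rw [Real.log_pow] at this
      push_cast at this
      linarith
    have h2 : Real.log (‖z‖ ^ 2 + ε ^ 2) ≤ ‖z‖ ^ 2 + ε ^ 2 - 1 :=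
      Real.log_le_sub_one_of_pos (by positivity)
    have h3 : ε ^ 2 ≤ 1 := by nlinarith [hε.1, hε.2]
    have h4 := neg_abs_le (Real.log ‖z‖)
    constructor <;> nlinarith [abs_nonneg (Real.log ‖z‖)]
  · have h0 : ∀ᵐ z : ℂ, z ≠ 0 := Measure.ae_ne volume 0
    filter_upwards [h0] with z hz
    have hz' : 0 < ‖z‖ := norm_pos_iff.2 hz
    refine Tendsto.smul_const ?_ _
    have h : Tendsto (fun ε : ℝ => 1 / 2 * Real.log (‖z‖ ^ 2 + ε ^ 2)) (𝓝 0)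
        (𝓝 (1 / 2 * Real.log (‖z‖ ^ 2 + 0 ^ 2))) := by
      refine ContinuousAt.tendsto (f := fun ε : ℝ => 1 / 2 * Real.log (‖z‖ ^ 2 + ε ^ 2)) ?_
      exact ((by fun_prop : ContinuousAt (fun ε : ℝ => ‖z‖ ^ 2 + ε ^ 2) 0).log
        (by positivity)).const_mul _
    have e : 1 / 2 * Real.log (‖z‖ ^ 2 + 0 ^ 2) = Real.log ‖z‖ := by
      rw [zero_pow two_ne_zero, add_zero, Real.log_pow]
      push_cast; ring
    rw [e] at h
    exact h.mono_left nhdsWithin_le_nhds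

/-- Green's identity followed by the scaling z ↦ εz, which moves all dependence on ε from the kernel
into φ. -/
lemma integral_half_log_sq [CompleteSpace E] {φ : ℂ → E} (hφ : ContDiff ℝ (⊤ : ℕ∞) φ)
    (hφc : HasCompactSupport φ) {ε : ℝ} (hε : 0 < ε) :
    ∫ z, (1 / 2 * Real.log (‖z‖ ^ 2 + ε ^ 2)) • Δ φ z =
      ∫ z : ℂ, (2 / (‖z‖ ^ 2 + 1) ^ 2) • φ (ε • z) := by
  rw [integral_smul_laplacian_of_analyticAt hφ hφc fun z _ => analyticAt_half_log_sq hε z]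
  simp_rw [laplacian_half_log_sq hε]
  have := Measure.integral_comp_smul (volume : Measure ℂ)
    (fun z => (2 * ε ^ 2 / (‖z‖ ^ 2 + ε ^ 2) ^ 2) • φ z) ε
  rw [Complex.finrank_real_complex, abs_of_pos (by positivity), eq_inv_smul_iff₀ (by positivity)]
    at this
  rw [← this, ← integral_smul]
  congr 1 with z
  rw [smul_smul, norm_smul, Real.norm_of_nonneg hε.le]
  congr 1
  field_simp

lemma tendsto_integral_poisson {φ : ℂ → E} [CompleteSpace E] (hφ : Continuous φ)
    (hφc : HasCompactSupport φ) :
    Tendsto (fun ε : ℝ => ∫ z : ℂ, (2 / (‖z‖ ^ 2 + 1) ^ 2) • φ (ε • z)) (𝓝[>] 0)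
      (𝓝 ((2 * Real.pi) • φ 0)) := by
  obtain ⟨C, hC⟩ := hφc.exists_bound_of_continuous hφ
  rw [← integral_two_div_one_add_norm_sq_sq, ← integral_smul_const]
  refine tendsto_integral_filter_of_dominated_convergence
    (fun z : ℂ => 2 / (‖z‖ ^ 2 + 1) ^ 2 * C) ?_ ?_
    (integrable_two_div_one_add_norm_sq_sq.mul_const C) ?_
  · refine Eventually.of_forall fun ε => Continuous.aestronglyMeasurable ?_
    refine Continuous.smul (f := fun z : ℂ => 2 / (‖z‖ ^ 2 + 1) ^ 2) ?_ (by fun_prop)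
    exact continuous_const.div (by fun_prop) fun z => by positivity
  · refine Eventually.of_forall fun ε => Eventually.of_forall fun z => ?_
    rw [norm_smul, Real.norm_of_nonneg (by positivity)]
    exact mul_le_mul_of_nonneg_left (hC _) (by positivity)
  · refine Eventually.of_forall fun z => Tendsto.const_smul ?_ _
    have : Tendsto (fun ε : ℝ => φ (ε • z)) (𝓝 0) (𝓝 (φ ((0 : ℝ) • z))) :=
      (by fun_prop : Continuous fun ε : ℝ => φ (ε • z)).tendsto 0
    rw [zero_smul] at this
    exact this.mono_left nhdsWithin_le_nhds

/-- `log ‖z - a‖ / 2π` is a fundamental solution of the Laplacian in the plane. -/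
lemma integral_log_norm_sub_smul_laplacian [CompleteSpace E] {φ : ℂ → E}
    (hφ : ContDiff ℝ (⊤ : ℕ∞) φ) (hφc : HasCompactSupport φ) (a : ℂ) :
    ∫ z, Real.log ‖z - a‖ • Δ φ z = (2 * Real.pi) • φ a := by
  have hφa : ContDiff ℝ (⊤ : ℕ∞) fun z => φ (z + a) := hφ.comp (contDiff_id.add contDiff_const)
  have hφca : HasCompactSupport fun z => φ (z + a) :=
    hφc.comp_homeomorph (Homeomorph.addRight a)
  have h2 : ContDiff ℝ 2 fun z => φ (z + a) := contDiff_infty.1 hφa 2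
  have h := tendsto_integral_half_log_sq h2 hφca
  have h' := tendsto_integral_poisson hφa.continuous hφca
  have e := tendsto_nhds_unique (h.congr' (by
    filter_upwards [self_mem_nhdsWithin] with ε hε using integral_half_log_sq hφa hφca hε)) h'
  rw [zero_add] at e
  rw [← e, ← integral_add_right_eq_self _ a]
  congr 1 with z
  rw [add_sub_cancel_right]
  congr 1
  rw [InnerProductSpace.laplacian_eq_iteratedFDeriv_complexPlane,
    InnerProductSpace.laplacian_eq_iteratedFDeriv_complexPlane]
  beta_reduce
  rw [iteratedFDeriv_comp_add_right]

end LogPotential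

/-! ### The zero measure of an analytic function and Green's formula. -/

section ZeroMeasure

variable {G : Set ℂ} {f : ℂ → ℂ}

lemma analyticOrderAt_ne_top_of_preconnected (hG : IsPreconnected G) (hf : AnalyticOnNhd ℂ f G)
    (hne : ∃ z ∈ G, f z ≠ 0) {z : ℂ} (hz : z ∈ G) : analyticOrderAt f z ≠ ⊤ := by
  intro h
  obtain ⟨w, hw, hfw⟩ := hne
  exact hfw (hf.eqOn_zero_of_preconnected_of_eventuallyEq_zero hG hz (analyticOrderAt_eq_top.1 h) hw)

lemma divisor_eq_analyticOrderNatAt {K : Set ℂ} (hf : AnalyticOnNhd ℂ f K) {z : ℂ} (hz : z ∈ K) :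
    MeromorphicOn.divisor f K z = (analyticOrderNatAt f z : ℤ) := by
  rw [MeromorphicOn.AnalyticOnNhd.divisor_apply hf hz, analyticOrderNatAt]
  cases h : analyticOrderAt f z with
  | top => simp
  | coe n => simp

lemma zeroMeasure_apply {s : Set ℂ} (hs : MeasurableSet s) :
    zeroMeasure G f s =
      ∑' z : G, ((analyticOrderAt f (z : ℂ) : ℕ∞) : ℝ≥0∞) * s.indicator 1 (z : ℂ) := by
  rw [zeroMeasure, Measure.sum_apply _ hs]
  simp [Measure.dirac_apply' _ hs]

lemma zeroMeasure_compl (hG : IsOpen G) : zeroMeasure G f Gᶜ = 0 := by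
  rw [zeroMeasure_apply hG.measurableSet.compl]
  simp

lemma zeroMeasure_congr {g : ℂ → ℂ} (hG : IsOpen G) (h : Set.EqOn f g G) :
    zeroMeasure G f = zeroMeasure G g := by
  unfold zeroMeasure
  congr 1 with z : 1
  rw [analyticOrderAt_congr (h.eventuallyEq_of_mem (hG.mem_nhds z.2))]

/-- On a compact subset of the domain the zero measure is a finite sum of point masses. -/
lemma zeroMeasure_restrict {K : Set ℂ} (hK : IsCompact K) (hKG : K ⊆ G)
    (hf : AnalyticOnNhd ℂ f G) (hord : ∀ z ∈ G, analyticOrderAt f z ≠ ⊤) :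
    (zeroMeasure G f).restrict K =
      ∑ u ∈ ((MeromorphicOn.divisor f K).finiteSupport hK).toFinset,
        (analyticOrderNatAt f u : ℝ≥0∞) • Measure.dirac u := by
  have hfK : AnalyticOnNhd ℂ f K := hf.mono hKG
  ext s hs
  rw [Measure.restrict_apply hs, zeroMeasure_apply (hs.inter hK.measurableSet)]
  simp only [Measure.coe_finsetSum, Finset.sum_apply, Measure.smul_apply, smul_eq_mul]
  set S := ((MeromorphicOn.divisor f K).finiteSupport hK).toFinset with hS
  have hSK : ∀ u ∈ S, u ∈ K := fun u hu =>
    (MeromorphicOn.divisor f K).supportWithinDomain (by simpa [hS] using hu)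
  have hval : ∀ z ∈ G, ((analyticOrderAt f z : ℕ∞) : ℝ≥0∞) = (analyticOrderNatAt f z : ℝ≥0∞) := by
    intro z hz
    rw [← Nat.cast_analyticOrderNatAt (hord z hz)]
    simp
  set T : Finset G := S.attach.image (fun u : {x // x ∈ S} => (⟨u.1, hKG (hSK u.1 u.2)⟩ : G)) with hT
  rw [tsum_eq_sum (s := T)]
  · rw [hT, Finset.sum_image (by
      intro a _ b _ h
      exact Subtype.ext (congrArg (fun x : G => (x : ℂ)) h)), ← Finset.sum_attach S]
    refine Finset.sum_congr rfl fun u _ => ?_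
    rw [hval _ (hKG (hSK u u.2)), Measure.dirac_apply' _ hs]
    congr 1
    by_cases h : (u : ℂ) ∈ s <;> simp [Set.indicator, h, hSK u u.2]
  · intro z hz
    by_cases hzs : (z : ℂ) ∈ s ∩ K
    · have hzS : (z : ℂ) ∉ S := by
        intro h
        exact hz (Finset.mem_image.2 ⟨⟨z.1, h⟩, Finset.mem_attach _ _, rfl⟩)
      have h0 : MeromorphicOn.divisor f K z = 0 := by simpa [hS] using hzS
      rw [divisor_eq_analyticOrderNatAt hfK hzs.2] at h0
      rw [hval z z.2]
      simp [Int.natCast_eq_zero.1 h0]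
    · simp [hzs]

lemma zeroMeasure_lt_top {K : Set ℂ} (hK : IsCompact K) (hKG : K ⊆ G)
    (hf : AnalyticOnNhd ℂ f G) (hord : ∀ z ∈ G, analyticOrderAt f z ≠ ⊤) :
    zeroMeasure G f K < ⊤ := by
  have : zeroMeasure G f K = (zeroMeasure G f).restrict K Set.univ := by simp
  rw [this, zeroMeasure_restrict hK hKG hf hord]
  simp [ENNReal.sum_lt_top]

variable {E : Type*} [NormedAddCommGroup E] [NormedSpace ℝ E]

omit [NormedSpace ℝ E] in
lemma integrable_zeroMeasure {φ : ℂ → E} (hφ : Continuous φ) (hφc : HasCompactSupport φ)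
    (hφG : tsupport φ ⊆ G)
    (hf : AnalyticOnNhd ℂ f G) (hord : ∀ z ∈ G, analyticOrderAt f z ≠ ⊤) :
    Integrable φ (zeroMeasure G f) := by
  rw [← integrableOn_iff_integrable_of_support_subset (subset_tsupport φ)]
  exact hφ.continuousOn.integrableOn_of_subset_isCompact hφc (isClosed_tsupport φ).measurableSet
    subset_rfl (zeroMeasure_lt_top hφc hφG hf hord).ne

lemma integral_zeroMeasure [CompleteSpace E] {φ : ℂ → E} (hφc : HasCompactSupport φ)
    (hφG : tsupport φ ⊆ G)
    (hf : AnalyticOnNhd ℂ f G) (hord : ∀ z ∈ G, analyticOrderAt f z ≠ ⊤) :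
    ∫ z, φ z ∂(zeroMeasure G f) =
      ∑ u ∈ ((MeromorphicOn.divisor f (tsupport φ)).finiteSupport hφc).toFinset,
        (analyticOrderNatAt f u : ℝ) • φ u := by
  rw [← setIntegral_eq_integral_of_forall_compl_eq_zero (s := tsupport φ)
    (fun z hz => image_eq_zero_of_notMem_tsupport hz), zeroMeasure_restrict hφc hφG hf hord,
    integral_finsetSum_measure]
  · simp [integral_smul_measure]
  · intro u _
    exact (integrable_dirac (by simp)).smul_measure (by simp)

/-- **Green's formula** for the zeros of an analytic function. -/
theorem integrable_and_integral_log_norm_smul_laplacian [CompleteSpace E] {φ : ℂ → E}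
    (hφ : ContDiff ℝ (⊤ : ℕ∞) φ) (hφc : HasCompactSupport φ) (hφG : tsupport φ ⊆ G)
    (hf : AnalyticOnNhd ℂ f G) (hord : ∀ z ∈ G, analyticOrderAt f z ≠ ⊤) :
    Integrable (fun z => Real.log ‖f z‖ • Δ φ z) ∧
      ∫ z, Real.log ‖f z‖ • Δ φ z = (2 * Real.pi) • ∫ z, φ z ∂(zeroMeasure G f) := by
  have hφ2 : ContDiff ℝ 2 φ := contDiff_infty.1 hφ 2
  set K := tsupport φ with hK
  have hKm : MeasurableSet K := (isClosed_tsupport φ).measurableSet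
  have hfK : AnalyticOnNhd ℂ f K := hf.mono hφG
  have hfin := (MeromorphicOn.divisor f K).finiteSupport hφc
  have hΔ : ∀ z ∉ K, Δ φ z = 0 := fun z hz =>
    image_eq_zero_of_notMem_tsupport fun h => hz (tsupport_laplacian_subset φ h)
  -- f is a finite product of powers of z - u times a zero-free g on K. Each log|z - u| contributes
  -- 2πφ(u) with multiplicity; log|g| is harmonic and contributes nothing.
  obtain ⟨g, hg, hg0, hfg⟩ := hfK.meromorphicOn.extract_zeros_poles (fun u => by
    rw [(hfK u u.2).meromorphicOrderAt_eq]
    simpa using hord u (hφG u.2)) hfin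
  have hlog := MeromorphicOn.extract_zeros_poles_log hg0 hfg
  have hsum : (∑ᶠ u, fun z => (MeromorphicOn.divisor f K u : ℝ) * Real.log ‖z - u‖) =
      fun z => ∑ u ∈ hfin.toFinset, (analyticOrderNatAt f u : ℝ) * Real.log ‖z - u‖ := by
    rw [finsum_eq_sum_of_support_subset (s := hfin.toFinset)]
    · funext z
      rw [Finset.sum_apply]
      refine Finset.sum_congr rfl fun u hu => ?_
      rw [divisor_eq_analyticOrderNatAt hfK
        ((MeromorphicOn.divisor f K).supportWithinDomain (by simpa using hu))]
      simp
    · intro u hu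
      simp only [Set.Finite.coe_toFinset, Function.mem_support] at hu ⊢
      intro h
      apply hu
      funext z
      simp [h]
  rw [hsum] at hlog
  -- The logarithmic identity holds off a discrete, hence Lebesgue-null, subset of K.
  have hae := ae_restrict_le_codiscreteWithin (μ := volume) hKm hlog
  replace hae := (ae_restrict_iff' hKm).1 hae
  have hcongr : (fun z => Real.log ‖f z‖ • Δ φ z) =ᵐ[volume]
      fun z => (∑ u ∈ hfin.toFinset, (analyticOrderNatAt f u : ℝ) • Real.log ‖z - u‖ • Δ φ z) +
        Real.log ‖g z‖ • Δ φ z := by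
    filter_upwards [hae] with z hz
    by_cases hzK : z ∈ K
    · rw [hz hzK, Pi.add_apply, add_smul, Finset.sum_smul]
      simp only [mul_smul]
    · simp [hΔ z hzK]
  have hint1 : ∀ u ∈ hfin.toFinset,
      Integrable fun z => (analyticOrderNatAt f u : ℝ) • Real.log ‖z - u‖ • Δ φ z := fun u _ =>
    ((locallyIntegrable_log_norm_sub u).integrable_smul_laplacian hφ2 hφc).smul _
  have hharm : ∀ z ∈ K, InnerProductSpace.HarmonicAt (fun z => Real.log ‖g z‖) z := fun z hz =>
    (hg z hz).harmonicAt_log_norm (hg0 ⟨z, hz⟩)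
  have hint2 : Integrable fun z => Real.log ‖g z‖ • Δ φ z := by
    rw [← integrableOn_iff_integrable_of_support_subset (s := K)]
    · refine ContinuousOn.integrableOn_compact hφc ?_
      refine ContinuousOn.smul (fun z hz => ?_) hφ2.continuous_laplacian.continuousOn
      exact (hharm z hz).1.continuousAt.continuousWithinAt
    · intro z hz
      by_contra h
      exact hz (by simp [hΔ z h])
  have hzero : ∫ z, Real.log ‖g z‖ • Δ φ z = 0 := by
    rw [integral_smul_laplacian_of_analyticAt hφ hφc fun z hz =>
      HarmonicAt.analyticAt (hharm z hz)]
    rw [← integral_zero ℂ E]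
    congr 1 with z
    by_cases hz : z ∈ K
    · rw [(hharm z hz).2.self_of_nhds]
      simp
    · rw [image_eq_zero_of_notMem_tsupport hz, smul_zero]
  refine ⟨((integrable_finsetSum _ hint1).add hint2).congr hcongr.symm, ?_⟩
  rw [integral_congr_ae hcongr, integral_add (integrable_finsetSum _ hint1) hint2, hzero,
    add_zero, integral_finsetSum _ hint1, integral_zeroMeasure hφc hφG hf hord, Finset.smul_sum]
  refine Finset.sum_congr rfl fun u _ => ?_
  rw [integral_smul, integral_log_norm_sub_smul_laplacian hφ hφc, smul_comm]

end ZeroMeasure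

/-! ### Measurability of the zero measure in ω. -/

section MeasurableZeros

variable {Ω : Type*} [MeasurableSpace Ω] {G : Set ℂ} {F : Ω → ℂ → ℂ}

/-- Green's formula replaces the sum over moving zeros by a Lebesgue integral of a jointly
measurable function. -/
lemma measurable_integral_zeroMeasure (hF : Measurable (Function.uncurry F))
    (hFa : ∀ ω, AnalyticOnNhd ℂ (F ω) G) (hord : ∀ ω, ∀ z ∈ G, analyticOrderAt (F ω) z ≠ ⊤)
    {χ : ℂ → ℝ} (hχ : ContDiff ℝ (⊤ : ℕ∞) χ) (hχc : HasCompactSupport χ) (hχG : tsupport χ ⊆ G) :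
    Measurable fun ω => ∫ z, χ z ∂(zeroMeasure G (F ω)) := by
  have h : ∀ ω, ∫ z, χ z ∂(zeroMeasure G (F ω)) =
      (2 * Real.pi)⁻¹ * ∫ z, Real.log ‖F ω z‖ • Δ χ z := fun ω => by
    rw [(integrable_and_integral_log_norm_smul_laplacian hχ hχc hχG (hFa ω) (hord ω)).2,
      smul_eq_mul, inv_mul_cancel_left₀ Real.two_pi_pos.ne']
  simp_rw [h]
  refine Measurable.const_mul ?_ _
  have hm : Measurable (Function.uncurry fun ω z => Real.log ‖F ω z‖ • Δ χ z) := by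
    have h2 := (contDiff_infty.1 hχ 2).continuous_laplacian.measurable
    exact (Real.measurable_log.comp hF.norm).mul (h2.comp measurable_snd)
  exact hm.stronglyMeasurable.integral_prod_right.measurable

/-- An open subset of the plane is exhausted by an increasing sequence of compact sets. -/
lemma exists_monotone_isCompact_iUnion {U : Set ℂ} (hU : IsOpen U) :
    ∃ K : ℕ → Set ℂ, (∀ n, IsCompact (K n)) ∧ (∀ n, K n ⊆ U) ∧ ⋃ n, K n = U ∧ Monotone K := by
  obtain ⟨C, hC, hCU, hCun, hCm⟩ := hU.exists_iUnion_isClosed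
  refine ⟨fun n => C n ∩ Metric.closedBall 0 n, fun n => (isCompact_closedBall _ _).inter_left (hC n),
    fun n => Set.inter_subset_left.trans (hCU n), ?_, ?_⟩
  · refine Set.Subset.antisymm (Set.iUnion_subset fun n => Set.inter_subset_left.trans (hCU n)) ?_
    intro z hz
    rw [← hCun] at hz
    obtain ⟨n, hn⟩ := Set.mem_iUnion.1 hz
    obtain ⟨m, hm⟩ := exists_nat_ge ‖z‖
    refine Set.mem_iUnion.2 ⟨max n m, hCm (le_max_left _ _) hn, ?_⟩
    rw [mem_closedBall_zero_iff]
    exact hm.trans (by exact_mod_cast le_max_right _ _)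
  · intro a b hab
    exact Set.inter_subset_inter (hCm hab) (Metric.closedBall_subset_closedBall (by exact_mod_cast hab))

/-- The mass of U is the supremum of integrals of smooth cut-offs supported in U and equal to 1 on
the sets of a compact exhaustion. -/
lemma measurable_zeroMeasure_of_isOpen (hF : Measurable (Function.uncurry F))
    (hFa : ∀ ω, AnalyticOnNhd ℂ (F ω) G) (hord : ∀ ω, ∀ z ∈ G, analyticOrderAt (F ω) z ≠ ⊤)
    {U : Set ℂ} (hU : IsOpen U) (hUG : U ⊆ G) :
    Measurable fun ω => zeroMeasure G (F ω) U := by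
  obtain ⟨K, hK, hKU, hKun, hKm⟩ := exists_monotone_isCompact_iUnion hU
  choose χ hχ hχc hχU hχ1 hχ01 using fun n => exists_cutoff (hK n) hU (hKU n)
  have h : ∀ ω, zeroMeasure G (F ω) U =
      ⨆ n, ENNReal.ofReal (∫ z, χ n z ∂(zeroMeasure G (F ω))) := by
    intro ω
    have hint : ∀ n, ENNReal.ofReal (∫ z, χ n z ∂(zeroMeasure G (F ω))) =
        ∫⁻ z, ENNReal.ofReal (χ n z) ∂(zeroMeasure G (F ω)) := fun n =>
      ofReal_integral_eq_lintegral_ofReal (integrable_zeroMeasure (hχ n).continuous (hχc n)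
        ((hχU n).trans hUG) (hFa ω) (hord ω)) (Eventually.of_forall fun z => (hχ01 n z).1)
    simp_rw [hint]
    refine le_antisymm ?_ (iSup_le fun n => ?_)
    · rw [← hKun, hKm.measure_iUnion]
      refine iSup_mono fun n => ?_
      rw [← lintegral_indicator_one (hK n).measurableSet]
      refine lintegral_mono fun z => ?_
      by_cases hz : z ∈ K n
      · simp [hz, ((eventually_nhdsSet_iff_forall.1 (hχ1 n)) z hz).self_of_nhds]
      · simp [hz]
    · rw [← lintegral_indicator_one hU.measurableSet]
      refine lintegral_mono fun z => ?_
      by_cases hz : z ∈ U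
      · simpa [hz] using (hχ01 n z).2
      · rw [image_eq_zero_of_notMem_tsupport fun h => hz (hχU n h)]
        simp
  simp_rw [h]
  exact .iSup fun n => (measurable_integral_zeroMeasure hF hFa hord (hχ n) (hχc n)
    ((hχU n).trans hUG)).ennreal_ofReal

/-- The zero measure of a jointly measurable random analytic function is a random measure. -/
theorem measurable_zeroMeasure (hG : IsOpen G) (hF : Measurable (Function.uncurry F))
    (hFa : ∀ ω, AnalyticOnNhd ℂ (F ω) G) (hord : ∀ ω, ∀ z ∈ G, analyticOrderAt (F ω) z ≠ ⊤) :
    Measurable fun ω => zeroMeasure G (F ω) := by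
  obtain ⟨K, hK, hKG, hKun, hKm⟩ := exists_monotone_isCompact_iUnion hG
  choose V hV hKV hVG hVc using fun n => exists_open_between_and_isCompact_closure (hK n) hG (hKG n)
  -- Passing from open sets to Borel sets by a π-system argument needs finite measures, hence the
  -- restriction to relatively compact V n.
  have hVm : ∀ n, Measurable fun ω => (zeroMeasure G (F ω)).restrict (V n) := by
    intro n
    have hfin : ∀ ω, IsFiniteMeasure ((zeroMeasure G (F ω)).restrict (V n)) := fun ω =>
      ⟨by
        rw [Measure.restrict_apply_univ]
        exact (measure_mono subset_closure).trans_lt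
          (zeroMeasure_lt_top (hVc n) (hVG n) (hFa ω) (hord ω))⟩
    have hopen : ∀ s, IsOpen s → Measurable fun ω => (zeroMeasure G (F ω)).restrict (V n) s := by
      intro s hs
      simp_rw [Measure.restrict_apply hs.measurableSet]
      exact measurable_zeroMeasure_of_isOpen hF hFa hord (hs.inter (hV n))
        (Set.inter_subset_right.trans (subset_closure.trans (hVG n)))
    exact Measurable.measure_of_isPiSystem (S := {s | IsOpen s})
      (BorelSpace.measurable_eq (α := ℂ)) isPiSystem_isOpen hopen (hopen _ isOpen_univ)
  refine Measure.measurable_of_measurable_coe _ fun B hB => ?_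
  have h : ∀ ω, zeroMeasure G (F ω) B = ⨆ n, (zeroMeasure G (F ω)).restrict (V n) B := by
    intro ω
    refine le_antisymm ?_ (iSup_le fun n => Measure.restrict_apply_le _ _)
    have h0 : zeroMeasure G (F ω) (B \ G) = 0 :=
      measure_mono_null (fun z hz => hz.2) (zeroMeasure_compl hG)
    calc zeroMeasure G (F ω) B ≤ zeroMeasure G (F ω) (B ∩ G) + zeroMeasure G (F ω) (B \ G) :=
          measure_le_inter_add_sdiff _ _ _
      _ = zeroMeasure G (F ω) (⋃ n, B ∩ K n) := by rw [h0, add_zero, ← Set.inter_iUnion, hKun]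
      _ = ⨆ n, zeroMeasure G (F ω) (B ∩ K n) :=
          Monotone.measure_iUnion fun a b hab => Set.inter_subset_inter_right _ (hKm hab)
      _ ≤ _ := by
          refine iSup_mono fun n => ?_
          rw [Measure.restrict_apply hB]
          exact measure_mono (Set.inter_subset_inter_right _ (hKV n))
  simp_rw [h]
  exact .iSup fun n => (Measure.measurable_coe hB).comp (hVm n)

end MeasurableZeros

/-! ### The standard complex Gaussian law and Gaussian series. -/

section StdComplexGaussian

instance : IsProbabilityMeasure stdComplexGaussian :=
  Measure.isProbabilityMeasure_map Complex.measurableEquivRealProd.symm.measurable.aemeasurable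

lemma stdComplexGaussian_eq_withDensity :
    stdComplexGaussian =
      volume.withDensity fun z : ℂ => ENNReal.ofReal (Real.pi⁻¹ * Real.exp (-‖z‖ ^ 2)) := by
  have hd : ∀ z : ℂ, gaussianPDF 0 (1 / 2) z.re * gaussianPDF 0 (1 / 2) z.im =
      ENNReal.ofReal (Real.pi⁻¹ * Real.exp (-‖z‖ ^ 2)) := by
    intro z
    rw [gaussianPDF, gaussianPDF, ← ENNReal.ofReal_mul (gaussianPDFReal_nonneg _ _ _)]
    congr 1
    simp only [gaussianPDFReal, sub_zero]
    have e1 : (2 * Real.pi * ((1 / 2 : NNReal) : ℝ)) = Real.pi := by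
      push_cast; ring
    have e2 : 2 * ((1 / 2 : NNReal) : ℝ) = 1 := by
      push_cast; ring
    have e3 : ‖z‖ ^ 2 = z.re ^ 2 + z.im ^ 2 := by
      rw [← Complex.normSq_eq_norm_sq, Complex.normSq_apply]; ring
    rw [e1, e2, e3, mul_mul_mul_comm, ← Real.exp_add, ← mul_inv, Real.mul_self_sqrt Real.pi_pos.le]
    congr 2
    ring
  have hv : (1 / 2 : NNReal) ≠ 0 := by simp
  rw [stdComplexGaussian, gaussianReal_of_var_ne_zero _ hv,
    prod_withDensity (measurable_gaussianPDF _ _) (measurable_gaussianPDF _ _)]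
  ext s hs
  rw [Measure.map_apply Complex.measurableEquivRealProd.symm.measurable hs,
    withDensity_apply _ (Complex.measurableEquivRealProd.symm.measurable hs),
    withDensity_apply _ hs]
  have := Complex.volume_preserving_equiv_real_prod.symm.setLIntegral_comp_preimage_emb
    Complex.measurableEquivRealProd.symm.measurableEmbedding
    (fun z : ℂ => ENNReal.ofReal (Real.pi⁻¹ * Real.exp (-‖z‖ ^ 2))) s
  rw [← this]
  congr 1 with p
  rw [← hd]
  rfl

lemma integral_stdComplexGaussian {E : Type*} [NormedAddCommGroup E] [NormedSpace ℝ E]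
    (f : ℂ → E) :
    ∫ z, f z ∂stdComplexGaussian = ∫ z : ℂ, (Real.pi⁻¹ * Real.exp (-‖z‖ ^ 2)) • f z := by
  rw [stdComplexGaussian_eq_withDensity, integral_withDensity_eq_integral_toReal_smul
    (by fun_prop) (by simp)]
  congr 1 with z
  rw [ENNReal.toReal_ofReal (by positivity)]

lemma stdComplexGaussian_singleton (a : ℂ) : stdComplexGaussian {a} = 0 := by
  rw [stdComplexGaussian_eq_withDensity]
  exact withDensity_absolutelyContinuous _ _ (measure_singleton a)

lemma integral_norm_rpow_stdComplexGaussian {q : ℝ} (hq : -2 < q) :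
    ∫ z, ‖z‖ ^ q ∂stdComplexGaussian = Real.Gamma ((q + 2) / 2) := by
  have h := Complex.integral_rpow_mul_exp_neg_rpow (p := 2) (by norm_num) hq
  rw [integral_stdComplexGaussian]
  have e : ∀ z : ℂ, (Real.pi⁻¹ * Real.exp (-‖z‖ ^ 2)) • ‖z‖ ^ q =
      Real.pi⁻¹ * (‖z‖ ^ q * Real.exp (-‖z‖ ^ (2 : ℝ))) := by
    intro z
    rw [Real.rpow_two, smul_eq_mul]
    ring
  simp_rw [e]
  rw [integral_const_mul, h]
  field_simp

lemma integrable_norm_rpow_stdComplexGaussian {q : ℝ} (hq : -2 < q) :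
    Integrable (fun z : ℂ => ‖z‖ ^ q) stdComplexGaussian := by
  by_contra h
  have := integral_norm_rpow_stdComplexGaussian hq
  rw [integral_undef h] at this
  exact (Real.Gamma_pos_of_pos (by linarith : 0 < (q + 2) / 2)).ne this

lemma integral_id_stdComplexGaussian : ∫ z, z ∂stdComplexGaussian = 0 := by
  rw [integral_stdComplexGaussian]
  have := integral_neg_eq_self (fun z : ℂ => (Real.pi⁻¹ * Real.exp (-‖z‖ ^ 2)) • z) volume
  simp only [norm_neg, smul_neg, integral_neg] at this
  exact self_eq_neg.1 this.symm

lemma integral_norm_sq_stdComplexGaussian : ∫ z, ‖z‖ ^ 2 ∂stdComplexGaussian = 1 := by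
  have := integral_norm_rpow_stdComplexGaussian (q := 2) (by norm_num)
  simp only [Real.rpow_two] at this
  rw [this]
  norm_num

lemma memLp_id_stdComplexGaussian : MemLp (fun z : ℂ => z) 2 stdComplexGaussian := by
  rw [memLp_two_iff_integrable_sq_norm (f := fun z : ℂ => z) (by fun_prop)]
  simpa using integrable_norm_rpow_stdComplexGaussian (q := 2) (by norm_num)

/-- Source of the constant 3: e^|log r| = max(r, 1/r) ≤ r + 1/r, whose mean is Γ(3/2) + Γ(1/2) =
(3/2)√π, and √π ≤ 2. -/
lemma integral_exp_abs_log_norm_stdComplexGaussian_le :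
    ∫⁻ z, ENNReal.ofReal (Real.exp |Real.log ‖z‖|) ∂stdComplexGaussian ≤ 3 := by
  have h1 := integrable_norm_rpow_stdComplexGaussian (q := 1) (by norm_num)
  have h2 := integrable_norm_rpow_stdComplexGaussian (q := -1) (by norm_num)
  have e1 := integral_norm_rpow_stdComplexGaussian (q := 1) (by norm_num)
  have e2 := integral_norm_rpow_stdComplexGaussian (q := -1) (by norm_num)
  have h0 : ∀ᵐ z ∂stdComplexGaussian, z ≠ 0 := by
    rw [ae_iff]
    simpa using stdComplexGaussian_singleton 0
  calc ∫⁻ z, ENNReal.ofReal (Real.exp |Real.log ‖z‖|) ∂stdComplexGaussian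
      ≤ ∫⁻ z, ENNReal.ofReal (‖z‖ ^ (1 : ℝ) + ‖z‖ ^ (-1 : ℝ)) ∂stdComplexGaussian := by
        refine lintegral_mono_ae ?_
        filter_upwards [h0] with z hz
        have hz' : 0 < ‖z‖ := norm_pos_iff.2 hz
        refine ENNReal.ofReal_le_ofReal ?_
        rw [Real.rpow_one, Real.rpow_neg_one]
        rcases abs_cases (Real.log ‖z‖) with ⟨h, -⟩ | ⟨h, -⟩
        · rw [h, Real.exp_log hz']
          linarith [inv_pos.2 hz']
        · rw [h, Real.exp_neg, Real.exp_log hz']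
          linarith
    _ = ENNReal.ofReal (∫ z, (‖z‖ ^ (1 : ℝ) + ‖z‖ ^ (-1 : ℝ)) ∂stdComplexGaussian) :=
        (ofReal_integral_eq_lintegral_ofReal (h1.add h2)
          (Eventually.of_forall fun z => add_nonneg (by positivity) (by positivity))).symm
    _ ≤ ENNReal.ofReal 3 := by
        refine ENNReal.ofReal_le_ofReal ?_
        rw [integral_add h1 h2, e1, e2]
        have g1 : Real.Gamma ((1 + 2) / 2) = 1 / 2 * √Real.pi := by
          rw [← Real.Gamma_one_half_eq, ← Real.Gamma_add_one (by norm_num)]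
          norm_num
        have g2 : Real.Gamma ((-1 + 2) / 2) = √Real.pi := by
          rw [← Real.Gamma_one_half_eq]
          norm_num
        rw [g1, g2]
        have : √Real.pi ≤ 2 := by
          rw [Real.sqrt_le_left (by norm_num)]
          linarith [Real.pi_le_four]
        linarith
    _ = 3 := by simp

lemma charFun_stdComplexGaussian (t : ℂ) :
    charFun stdComplexGaussian t = Complex.exp (-(‖t‖ ^ 2 / 4 : ℝ)) := by
  rw [charFun_apply, stdComplexGaussian,
    integral_map_equiv]
  have h : ∀ p : ℝ × ℝ, Complex.exp (inner ℝ (Complex.measurableEquivRealProd.symm p) t * Complex.I) =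
      Complex.exp (inner ℝ p.1 t.re * Complex.I) * Complex.exp (inner ℝ p.2 t.im * Complex.I) := by
    intro p
    rw [← Complex.exp_add, ← add_mul, ← Complex.ofReal_add]
    congr 3
    rw [Complex.inner]
    simp [Complex.measurableEquivRealProd]
  simp_rw [h]
  rw [integral_prod_mul (fun x : ℝ => Complex.exp (inner ℝ x t.re * Complex.I))
    (fun x : ℝ => Complex.exp (inner ℝ x t.im * Complex.I)), ← charFun_apply, ← charFun_apply,
    charFun_gaussianReal, charFun_gaussianReal, ← Complex.exp_add]
  congr 1
  rw [← Complex.normSq_eq_norm_sq, Complex.normSq_apply]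
  push_cast
  ring

variable {Ω : Type*} [MeasurableSpace Ω] {P : Measure Ω} [IsProbabilityMeasure P]
  {X : ℕ → Ω → ℂ} {c : ℕ → ℂ}

omit [IsProbabilityMeasure P] in
lemma charFun_map_mul_const {Y : Ω → ℂ} (hY : AEMeasurable Y P) (a t : ℂ) :
    charFun (P.map fun ω => Y ω * a) t = charFun (P.map Y) (t * starRingEnd ℂ a) := by
  rw [charFun_apply, charFun_apply, integral_map (hY.mul_const a) (by fun_prop),
    integral_map hY (by fun_prop)]
  congr 1 with ω
  congr 3
  rw [Complex.inner, Complex.inner, map_mul]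
  ring_nf

/-- The alternative `c j = 0` admits the padding terms used when N is finite, whose coefficients
need not be Gaussian. -/
lemma charFun_map_sum_gaussian (hXm : ∀ j, Measurable (X j)) (hXi : iIndepFun X P)
    (hlaw : ∀ j, P.map (X j) = stdComplexGaussian ∨ c j = 0) (n : ℕ) (t : ℂ) :
    charFun (P.map fun ω => ∑ j ∈ Finset.range n, X j ω * c j) t =
      Complex.exp (-((∑ j ∈ Finset.range n, ‖c j‖ ^ 2) * ‖t‖ ^ 2 / 4 : ℝ)) := by
  have hind : iIndepFun ((Finset.range n).restrict fun j ω => X j ω * c j) P :=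
    (hXi.comp (fun j z => z * c j) fun j => by fun_prop).precomp
      (g := fun j : Finset.range n => (j : ℕ)) Subtype.val_injective
  rw [iIndepFun.charFun_map_fun_finsetSum_eq_prod
    (fun j _ => ((hXm j).mul_const _).aemeasurable) hind, Finset.prod_apply]
  have h : ∀ j ∈ Finset.range n, charFun (P.map fun ω => X j ω * c j) t =
      Complex.exp (-(‖c j‖ ^ 2 * ‖t‖ ^ 2 / 4 : ℝ)) := by
    intro j _
    rw [charFun_map_mul_const (hXm j).aemeasurable]
    rcases hlaw j with h | h
    · rw [h, charFun_stdComplexGaussian, norm_mul, RCLike.norm_conj]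
      congr 3
      ring
    · have := Measure.isProbabilityMeasure_map (hXm j).aemeasurable (μ := P)
      simp [h]
  rw [Finset.prod_congr rfl h, ← Complex.exp_sum]
  congr 1
  push_cast
  rw [Finset.sum_neg_distrib, Finset.sum_mul, Finset.sum_div]

/-- An almost surely convergent Gaussian series has the Gaussian law of the summed variance. -/
lemma map_tsum_gaussian (hXm : ∀ j, Measurable (X j)) (hXi : iIndepFun X P)
    (hlaw : ∀ j, P.map (X j) = stdComplexGaussian ∨ c j = 0)
    {V : ℝ} (hV : HasSum (fun j => ‖c j‖ ^ 2) V) {Y : Ω → ℂ} (hY : Measurable Y)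
    (hlim : ∀ᵐ ω ∂P, Tendsto (fun n => ∑ j ∈ Finset.range n, X j ω * c j) atTop (𝓝 (Y ω))) :
    P.map Y = stdComplexGaussian.map fun z => √V • z := by
  have := Measure.isProbabilityMeasure_map hY.aemeasurable (μ := P)
  have := Measure.isProbabilityMeasure_map (μ := stdComplexGaussian) (f := fun z : ℂ => √V • z)
    (by fun_prop)
  have hV0 : 0 ≤ V := hV.nonneg fun j => by positivity
  refine Measure.ext_of_charFun (funext fun t => ?_)
  rw [charFun_map_smul, charFun_stdComplexGaussian, norm_smul, mul_pow,
    Real.norm_of_nonneg (Real.sqrt_nonneg V), Real.sq_sqrt hV0]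
  -- Two limits of the same characteristic functions are compared: dominated convergence along the
  -- almost sure limit, and the explicit Gaussian formula for finite sums.
  have h1 : Tendsto (fun n => charFun (P.map fun ω => ∑ j ∈ Finset.range n, X j ω * c j) t) atTop
      (𝓝 (charFun (P.map Y) t)) := by
    have hS : ∀ n, Measurable fun ω => ∑ j ∈ Finset.range n, X j ω * c j := fun n => by fun_prop
    simp_rw [charFun_apply]
    rw [integral_map hY.aemeasurable (by fun_prop)]
    simp_rw [fun n => integral_map (μ := P) (hS n).aemeasurable
      (f := fun z : ℂ => Complex.exp (inner ℝ z t * Complex.I)) (by fun_prop)]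
    refine tendsto_integral_of_dominated_convergence (fun _ => 1) (fun n => ?_)
      (integrable_const _) (fun n => ?_) ?_
    · exact Measurable.aestronglyMeasurable (by fun_prop)
    · exact Eventually.of_forall fun ω => (Complex.norm_exp_ofReal_mul_I _).le
    · filter_upwards [hlim] with ω hω
      exact ((by fun_prop : Continuous fun z : ℂ => Complex.exp (inner ℝ z t * Complex.I)).tendsto
        (Y ω)).comp hω
  have h2 : Tendsto (fun n => charFun (P.map fun ω => ∑ j ∈ Finset.range n, X j ω * c j) t) atTop
      (𝓝 (Complex.exp (-(V * ‖t‖ ^ 2 / 4 : ℝ)))) := by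
    simp_rw [charFun_map_sum_gaussian hXm hXi hlaw]
    exact ((by fun_prop : Continuous fun x : ℝ => Complex.exp (-(x * ‖t‖ ^ 2 / 4 : ℝ))).tendsto
      V).comp hV.tendsto_sum_nat
  exact tendsto_nhds_unique h1 h2

end StdComplexGaussian

/-! ### Almost sure convergence of Hilbert-space valued random series. -/

section RandomSeries

variable {Ω : Type*} [MeasurableSpace Ω] {P : Measure Ω} [IsProbabilityMeasure P]
  {X : ℕ → Ω → ℂ}
  {H : Type*} [NormedAddCommGroup H] [InnerProductSpace ℂ H]

/-- Partial sums of a vector-valued random series. -/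
def vectorPartialSum (X : ℕ → Ω → ℂ) (v : ℕ → H) (n : ℕ) (ω : Ω) : H :=
  ∑ j ∈ Finset.range n, X j ω • v j

omit [IsProbabilityMeasure P] in
lemma memLp_vectorPartialSum (hX2 : ∀ j, MemLp (X j) 2 P) (v : ℕ → H) (n : ℕ) :
    MemLp (vectorPartialSum X v n) 2 P :=
  memLp_finsetSum _ fun j _ =>
    (ContinuousLinearMap.toSpanSingleton ℂ (v j)).comp_memLp' (hX2 j)

omit [IsProbabilityMeasure P] in
lemma stronglyMeasurable_vectorPartialSum (hX : ∀ j, StronglyMeasurable (X j)) (v : ℕ → H) (n : ℕ) :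
    StronglyMeasurable[Filtration.natural X hX n] (vectorPartialSum X v (n + 1)) := by
  refine Finset.stronglyMeasurable_fun_sum _ fun j hj => ?_
  have h1 : StronglyMeasurable[Filtration.natural X hX j] (X j) :=
    Filtration.stronglyAdapted_natural hX j
  exact (h1.mono ((Filtration.natural X hX).mono (Nat.lt_succ_iff.1 (Finset.mem_range.1 hj)))).smul
    stronglyMeasurable_const

-- The cross term vanishes because X (n + 1) is centred and independent of the past, which contains
-- s. This gives both the submartingale property and the variance bound. The sum of the first n + 1
-- terms uses X 0, …, X n, so it is measurable at time n.
omit [IsProbabilityMeasure P] in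
lemma setIntegral_norm_sq_vectorPartialSum_succ (hX : ∀ j, StronglyMeasurable (X j))
    (hXi : iIndepFun X P) (hX2 : ∀ j, MemLp (X j) 2 P) (hX0 : ∀ j, ∫ ω, X j ω ∂P = 0)
    (v : ℕ → H) (n : ℕ) {s : Set Ω} (hs : MeasurableSet[Filtration.natural X hX n] s) :
    ∫ ω in s, ‖vectorPartialSum X v (n + 2) ω‖ ^ 2 ∂P =
      ∫ ω in s, ‖vectorPartialSum X v (n + 1) ω‖ ^ 2 ∂P +
        ‖v (n + 1)‖ ^ 2 * ∫ ω in s, ‖X (n + 1) ω‖ ^ 2 ∂P := by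
  set T := vectorPartialSum X v (n + 1) with hT
  have hsm : MeasurableSet s := (Filtration.natural X hX).le n s hs
  have hT2 : MemLp T 2 P := memLp_vectorPartialSum hX2 v _
  have hTm := stronglyMeasurable_vectorPartialSum hX v n
  have hIm : StronglyMeasurable[Filtration.natural X hX n]
      (s.indicator fun ω => inner ℂ (T ω) (v (n + 1))) :=
    (hTm.inner stronglyMeasurable_const).indicator hs
  have hI2 : MemLp (fun ω => inner ℂ (T ω) (v (n + 1))) 2 P := hT2.inner_const _
  have hXI : Integrable (fun ω => X (n + 1) ω * inner ℂ (T ω) (v (n + 1))) P :=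
    (hX2 (n + 1)).integrable_mul hI2
  have hind : IndepFun (X (n + 1)) (s.indicator fun ω => inner ℂ (T ω) (v (n + 1))) P := by
    rw [IndepFun_iff_Indep]
    exact indep_of_indep_of_le_right (hXi.indep_comap_natural_of_lt hX (Nat.lt_succ_self n))
      hIm.measurable.comap_le
  have hcross : ∫ ω in s, X (n + 1) ω * inner ℂ (T ω) (v (n + 1)) ∂P = 0 := by
    rw [← integral_indicator hsm]
    have e : (s.indicator fun ω => X (n + 1) ω * inner ℂ (T ω) (v (n + 1))) =
        fun ω => X (n + 1) ω * (s.indicator fun ω => inner ℂ (T ω) (v (n + 1))) ω := by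
      funext ω
      by_cases h : ω ∈ s <;> simp [h]
    rw [e, hind.integral_fun_mul_eq_mul_integral (hX _).aestronglyMeasurable
      (hIm.mono ((Filtration.natural X hX).le n)).aestronglyMeasurable, hX0, zero_mul]
  have hpt : ∀ ω, ‖vectorPartialSum X v (n + 2) ω‖ ^ 2 =
      ‖T ω‖ ^ 2 + 2 * (X (n + 1) ω * inner ℂ (T ω) (v (n + 1))).re +
        ‖v (n + 1)‖ ^ 2 * ‖X (n + 1) ω‖ ^ 2 := by
    intro ω
    have : vectorPartialSum X v (n + 2) ω = T ω + X (n + 1) ω • v (n + 1) :=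
      Finset.sum_range_succ _ _
    rw [this, norm_add_sq (𝕜 := ℂ), inner_smul_right, norm_smul]
    simp only [RCLike.re_to_complex]
    ring
  simp_rw [hpt]
  have i1 : Integrable (fun ω => ‖T ω‖ ^ 2) (P.restrict s) := hT2.integrable_norm_pow (by simp) |>.integrableOn
  have i2 : Integrable (fun ω => 2 * (X (n + 1) ω * inner ℂ (T ω) (v (n + 1))).re) (P.restrict s) :=
    (hXI.re.const_mul 2).integrableOn
  have i3 : Integrable (fun ω => ‖v (n + 1)‖ ^ 2 * ‖X (n + 1) ω‖ ^ 2) (P.restrict s) :=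
    (((hX2 (n + 1)).integrable_norm_pow (by simp)).const_mul _).integrableOn
  rw [integral_add (by exact i1.add i2) i3, integral_add i1 i2, integral_const_mul, integral_const_mul]
  have : ∫ ω in s, (X (n + 1) ω * inner ℂ (T ω) (v (n + 1))).re ∂P = 0 := by
    have := integral_re (μ := P.restrict s) hXI.integrableOn (𝕜 := ℂ)
    simp only [RCLike.re_to_complex] at this
    rw [this, hcross, Complex.zero_re]
  rw [this]
  ring

lemma submartingale_norm_sq_vectorPartialSum (hX : ∀ j, StronglyMeasurable (X j))
    (hXi : iIndepFun X P) (hX2 : ∀ j, MemLp (X j) 2 P) (hX0 : ∀ j, ∫ ω, X j ω ∂P = 0)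
    (v : ℕ → H) :
    Submartingale (fun n ω => ‖vectorPartialSum X v (n + 1) ω‖ ^ 2) (Filtration.natural X hX) P := by
  refine submartingale_of_setIntegral_le_succ (fun n => ?_) (fun n => ?_) fun n s hs => ?_
  · exact (stronglyMeasurable_vectorPartialSum hX v n).norm.pow 2
  · exact (memLp_vectorPartialSum hX2 v _).integrable_norm_pow (by simp)
  · rw [setIntegral_norm_sq_vectorPartialSum_succ hX hXi hX2 hX0 v n hs]
    exact le_add_of_nonneg_right (mul_nonneg (sq_nonneg _) (integral_nonneg fun ω => sq_nonneg _))

omit [IsProbabilityMeasure P] in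
lemma integral_norm_sq_vectorPartialSum_le (hX : ∀ j, StronglyMeasurable (X j))
    (hXi : iIndepFun X P) (hX2 : ∀ j, MemLp (X j) 2 P) (hX0 : ∀ j, ∫ ω, X j ω ∂P = 0)
    (hX1 : ∀ j, ∫ ω, ‖X j ω‖ ^ 2 ∂P ≤ 1) (v : ℕ → H) (n : ℕ) :
    ∫ ω, ‖vectorPartialSum X v (n + 1) ω‖ ^ 2 ∂P ≤ ∑ j ∈ Finset.range (n + 1), ‖v j‖ ^ 2 := by
  induction n with
  | zero =>
    simp only [vectorPartialSum, zero_add, Finset.range_one, Finset.sum_singleton, norm_smul,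
      mul_pow]
    rw [integral_mul_const]
    exact mul_le_of_le_one_left (sq_nonneg _) (hX1 0)
  | succ n ih =>
    have := setIntegral_norm_sq_vectorPartialSum_succ hX hXi hX2 hX0 v n MeasurableSet.univ
    simp only [Measure.restrict_univ] at this
    rw [this, Finset.sum_range_succ _ (n + 1)]
    exact add_le_add ih (mul_le_of_le_one_right (sq_nonneg _) (hX1 _))

/-- **Kolmogorov's maximal inequality** for Hilbert-space valued random series. -/
lemma mul_measure_exists_le_norm_sq_vectorPartialSum (hX : ∀ j, StronglyMeasurable (X j))
    (hXi : iIndepFun X P) (hX2 : ∀ j, MemLp (X j) 2 P) (hX0 : ∀ j, ∫ ω, X j ω ∂P = 0)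
    (hX1 : ∀ j, ∫ ω, ‖X j ω‖ ^ 2 ∂P ≤ 1) (v : ℕ → H) (hv : Summable fun j => ‖v j‖ ^ 2)
    (ε : NNReal) :
    ε * P {ω | ∃ k, (ε : ℝ) ≤ ‖vectorPartialSum X v (k + 1) ω‖ ^ 2} ≤
      ENNReal.ofReal (∑' j, ‖v j‖ ^ 2) := by
  have hsub := submartingale_norm_sq_vectorPartialSum hX hXi hX2 hX0 v
  have hset : {ω | ∃ k, (ε : ℝ) ≤ ‖vectorPartialSum X v (k + 1) ω‖ ^ 2} =
      ⋃ n : ℕ, {ω | (ε : ℝ) ≤ (Finset.range (n + 1)).sup' Finset.nonempty_range_add_one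
        fun k => ‖vectorPartialSum X v (k + 1) ω‖ ^ 2} := by
    ext ω
    simp only [Set.mem_ofPred_eq, Set.mem_iUnion, Finset.le_sup'_iff]
    constructor
    · rintro ⟨k, hk⟩
      exact ⟨k, k, Finset.self_mem_range_succ k, hk⟩
    · rintro ⟨n, k, -, hk⟩
      exact ⟨k, hk⟩
  have hmono : Monotone fun n : ℕ => {ω | (ε : ℝ) ≤ (Finset.range (n + 1)).sup'
      Finset.nonempty_range_add_one fun k => ‖vectorPartialSum X v (k + 1) ω‖ ^ 2} := by
    intro a b hab ω hω
    simp only [Set.mem_ofPred_eq] at hω ⊢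
    exact hω.trans (Finset.sup'_mono _ (Finset.range_subset_range.2 (by omega)) _)
  rw [hset, hmono.measure_iUnion, ENNReal.mul_iSup]
  refine iSup_le fun n => (maximal_ineq hsub (fun n ω => sq_nonneg _) n).trans ?_
  refine ENNReal.ofReal_le_ofReal ?_
  calc _ ≤ ∫ ω, ‖vectorPartialSum X v (n + 1) ω‖ ^ 2 ∂P :=
        setIntegral_le_integral (hsub.integrable n) (Eventually.of_forall fun ω => sq_nonneg _)
    _ ≤ _ := integral_norm_sq_vectorPartialSum_le hX hXi hX2 hX0 hX1 v n
    _ ≤ _ := hv.sum_le_tsum _ fun j _ => sq_nonneg _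

/-- An independent random series with summable variances is almost surely Cauchy. -/
theorem ae_cauchySeq_vectorPartialSum (hX : ∀ j, StronglyMeasurable (X j))
    (hXi : iIndepFun X P) (hX2 : ∀ j, MemLp (X j) 2 P) (hX0 : ∀ j, ∫ ω, X j ω ∂P = 0)
    (hX1 : ∀ j, ∫ ω, ‖X j ω‖ ^ 2 ∂P ≤ 1) (v : ℕ → H) (hv : Summable fun j => ‖v j‖ ^ 2) :
    ∀ᵐ ω ∂P, CauchySeq fun n => vectorPartialSum X v n ω := by
  -- w m is the series with its first m coefficients removed; its partial sums are increments of the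
  -- original ones from time m on.
  set w : ℕ → ℕ → H := fun m j => if j < m then 0 else v j with hw
  have hwle : ∀ m j, ‖w m j‖ ^ 2 ≤ ‖v j‖ ^ 2 := by
    intro m j
    by_cases h : j < m <;> simp [hw, h]
  have hws : ∀ m, Summable fun j => ‖w m j‖ ^ 2 := fun m =>
    hv.of_nonneg_of_le (fun j => sq_nonneg _) (hwle m)
  have htail : Tendsto (fun m => ∑' j, ‖w m j‖ ^ 2) atTop (𝓝 0) := by
    have : ∀ m, ∑' j, ‖w m j‖ ^ 2 = ∑' j, ‖v (j + m)‖ ^ 2 := by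
      intro m
      rw [← (hws m).sum_add_tsum_nat_add m, Finset.sum_eq_zero, zero_add]
      · simp [hw]
      · intro j hj
        simp [hw, Finset.mem_range.1 hj]
    simp_rw [this]
    exact tendsto_sum_nat_add fun j => ‖v j‖ ^ 2
  have hdiff : ∀ m k ω, m ≤ k + 1 → vectorPartialSum X (w m) (k + 1) ω =
      vectorPartialSum X v (k + 1) ω - vectorPartialSum X v m ω := by
    intro m k ω hmk
    rw [eq_sub_iff_add_eq', vectorPartialSum, vectorPartialSum, vectorPartialSum,
      ← Finset.sum_range_add_sum_Ico _ hmk, ← Finset.sum_range_add_sum_Ico _ hmk,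
      Finset.sum_eq_zero (s := Finset.range m) (f := fun j => X j ω • w m j), zero_add]
    · congr 1
      refine Finset.sum_congr rfl fun j hj => ?_
      simp [hw, (Finset.mem_Ico.1 hj).1.not_gt]
    · intro j hj
      simp [hw, Finset.mem_range.1 hj]
  have hnull : ∀ i : ℕ, ∀ᵐ ω ∂P, ∃ m, ∀ k,
      ‖vectorPartialSum X (w m) (k + 1) ω‖ ^ 2 < ((1 / (i + 1 : NNReal) : NNReal) : ℝ) := by
    intro i
    set ε : NNReal := 1 / (i + 1 : NNReal) with hε
    have hε0 : (ε : ℝ≥0∞) ≠ 0 := by simp [hε]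
    -- The exceptional event does not depend on m and lies in the m-th maximal event for every m, so
    -- its measure is bounded by tails tending to 0.
    have hb : ∀ m, ε * P {ω | ¬ ∃ m, ∀ k, ‖vectorPartialSum X (w m) (k + 1) ω‖ ^ 2 < (ε : ℝ)} ≤
        ENNReal.ofReal (∑' j, ‖w m j‖ ^ 2) := by
      intro m
      refine le_trans ?_ (mul_measure_exists_le_norm_sq_vectorPartialSum hX hXi hX2 hX0 hX1 (w m)
        (hws m) ε)
      gcongr
      intro hω
      push Not at hω
      exact hω m
    have hlim := (ENNReal.continuous_ofReal.tendsto 0).comp htail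
    rw [ENNReal.ofReal_zero] at hlim
    have h0 := ge_of_tendsto' hlim hb
    rw [ae_iff]
    exact (mul_eq_zero.1 (le_zero_iff.1 h0)).resolve_left hε0
  filter_upwards [ae_all_iff.2 hnull] with ω hω
  rw [Metric.cauchySeq_iff']
  intro δ hδ
  obtain ⟨i, hi⟩ := exists_nat_one_div_lt (show (0 : ℝ) < δ ^ 2 by positivity)
  obtain ⟨m, hm⟩ := hω i
  refine ⟨m, fun n hn => ?_⟩
  rcases hn.eq_or_lt with rfl | hlt
  · simpa using hδ
  · obtain ⟨k, rfl⟩ : ∃ k, n = k + 1 := ⟨n - 1, by omega⟩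
    rw [dist_eq_norm, ← hdiff m k ω hlt.le]
    refine lt_of_pow_lt_pow_left₀ 2 hδ.le ((hm k).trans ?_)
    simpa using hi

end RandomSeries

/-! ### L² on a circle and Cauchy's formula. -/

section CircleL2

/-- Arc length (in the angle) on the circle. -/
noncomputable abbrev angleMeasure : Measure ℝ := volume.restrict (Set.Ioc 0 (2 * Real.pi))

lemma integral_norm_le_sqrt_mul_norm_Lp (u : Lp ℂ 2 angleMeasure) :
    ∫ θ, ‖u θ‖ ∂angleMeasure ≤ √(2 * Real.pi) * ‖u‖ := by
  have h := eLpNorm_le_eLpNorm_mul_rpow_measure_univ (p := 1) (q := 2) (μ := angleMeasure)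
    (by norm_num) (Lp.aestronglyMeasurable u)
  rw [integral_norm_eq_lintegral_enorm (Lp.aestronglyMeasurable u), ← eLpNorm_one_eq_lintegral_enorm,
    Lp.norm_def, mul_comm]
  refine (ENNReal.toReal_mono ?_ h).trans_eq ?_
  · exact ENNReal.mul_ne_top (Lp.eLpNorm_ne_top u) (by
      refine ENNReal.rpow_ne_top_of_nonneg (by norm_num) (measure_ne_top _ _))
  · rw [ENNReal.toReal_mul, ← ENNReal.toReal_rpow]
    congr 1
    rw [Real.sqrt_eq_rpow]
    congr 1
    · simp [Real.pi_pos.le]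
    · norm_num

lemma norm_sq_toLp_angleMeasure {u : ℝ → ℂ} (hu : MemLp u 2 angleMeasure) :
    ‖hu.toLp u‖ ^ 2 = ∫ θ, ‖u θ‖ ^ 2 ∂angleMeasure := by
  have h := L2.inner_def (𝕜 := ℂ) (hu.toLp u) (hu.toLp u)
  rw [inner_self_eq_norm_sq_to_K] at h
  have e : ∫ θ, inner ℂ ((hu.toLp u) θ) ((hu.toLp u) θ) ∂angleMeasure =
      ((∫ θ, ‖u θ‖ ^ 2 ∂angleMeasure : ℝ) : ℂ) := by
    rw [← integral_complex_ofReal]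
    refine integral_congr_ae ?_
    filter_upwards [hu.coeFn_toLp] with θ hθ
    rw [hθ, inner_self_eq_norm_sq_to_K]
    simp
  rw [e] at h
  exact Complex.ofReal_injective ((Complex.ofReal_pow _ 2).trans h)

lemma memLp_angleMeasure {u : ℝ → ℂ} (hu : Continuous u) : MemLp u 2 angleMeasure := by
  obtain ⟨C, hC⟩ := isCompact_Icc.exists_bound_of_continuousOn
    (hu.continuousOn (s := Set.Icc 0 (2 * Real.pi)))
  refine MemLp.of_bound hu.aestronglyMeasurable C ?_
  filter_upwards [ae_restrict_mem measurableSet_Ioc] with θ hθ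
  exact hC θ (Set.Ioc_subset_Icc_self hθ)

/-- An analytic function is controlled on the half-size disc by its mean over the circle. -/
lemma norm_le_integral_norm_circleMap {f : ℂ → ℂ} {a z : ℂ} {R : ℝ} (hR : 0 < R)
    (hf : DiffContOnCl ℂ f (Metric.ball a R)) (hz : z ∈ Metric.ball a (R / 2)) :
    ‖f z‖ ≤ ∫ θ, ‖f (circleMap a R θ)‖ ∂angleMeasure := by
  have hzR : z ∈ Metric.ball a R := Metric.ball_subset_ball (by linarith) hz
  have hcont : Continuous fun θ => f (circleMap a R θ) :=
    hf.continuousOn.comp_continuous (continuous_circleMap a R) fun θ => by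
      rw [closure_ball a hR.ne']
      exact circleMap_mem_closedBall a hR.le θ
  have hI : IntervalIntegrable (fun θ => 2 * ‖f (circleMap a R θ)‖) volume 0 (2 * Real.pi) :=
    (continuous_const.mul hcont.norm).intervalIntegrable _ _
  have h1 := hf.circleIntegral_sub_inv_smul hzR
  have h2 : ‖∮ w in C(a, R), (w - z)⁻¹ • f w‖ ≤
      ∫ θ in (0 : ℝ)..(2 * Real.pi), 2 * ‖f (circleMap a R θ)‖ := by
    refine intervalIntegral.norm_integral_le_of_norm_le Real.two_pi_pos.le
      (Eventually.of_forall fun θ _ => ?_) hI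
    rw [deriv_circleMap, norm_smul, norm_smul, norm_mul, Complex.norm_I, mul_one, norm_circleMap_zero,
      abs_of_pos hR, norm_inv, ← mul_assoc]
    refine mul_le_mul_of_nonneg_right ?_ (norm_nonneg _)
    -- On the circle |w - z| ≥ R/2, so R|w - z|⁻¹ ≤ 2. Cauchy's formula then yields the factor 1/π,
    -- which is discarded.
    have h3 : R / 2 ≤ ‖circleMap a R θ - z‖ := by
      have e1 : dist (circleMap a R θ) a = R := by
        rw [dist_eq_norm, circleMap_sub_center, norm_circleMap_zero, abs_of_pos hR]
      have e2 := dist_triangle (circleMap a R θ) z a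
      rw [Metric.mem_ball] at hz
      rw [← dist_eq_norm]
      linarith
    rw [← div_eq_mul_inv, div_le_iff₀ (by linarith)]
    linarith
  rw [h1, norm_smul, intervalIntegral.integral_const_mul,
    intervalIntegral.integral_of_le Real.two_pi_pos.le] at h2
  have h4 : ‖(2 * Real.pi * Complex.I : ℂ)‖ = 2 * Real.pi := by
    simp [Real.pi_pos.le]
  rw [h4] at h2
  nlinarith [Real.pi_gt_three, norm_nonneg (f z)]

end CircleL2

/-! ### Locally uniform convergence of random analytic series. -/

section LocallyUniform

variable {Ω : Type*} [MeasurableSpace Ω] {P : Measure Ω} [IsProbabilityMeasure P]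
  {X : ℕ → Ω → ℂ} {G : Set ℂ} {c : ℕ → ℂ → ℂ} {V : ℂ → ℝ}

/-- The restrictions of the c j to the circle are vectors in L² whose squared norms sum to at most
2π sup V. The Hilbert-space series is therefore almost surely Cauchy, and Cauchy's formula turns L²
control on the circle into uniform control inside. -/
lemma ae_uniformCauchySeqOn_ball (hX : ∀ j, StronglyMeasurable (X j))
    (hXi : iIndepFun X P) (hX2 : ∀ j, MemLp (X j) 2 P) (hX0 : ∀ j, ∫ ω, X j ω ∂P = 0)
    (hX1 : ∀ j, ∫ ω, ‖X j ω‖ ^ 2 ∂P ≤ 1)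
    (hc : ∀ j, DifferentiableOn ℂ (c j) G)
    (hV : ∀ z ∈ G, HasSum (fun j => ‖c j z‖ ^ 2) (V z)) (hVc : ContinuousOn V G)
    {a : ℂ} {R : ℝ} (hR : 0 < R) (haG : Metric.closedBall a R ⊆ G) :
    ∀ᵐ ω ∂P, UniformCauchySeqOn (fun n z => ∑ j ∈ Finset.range n, X j ω * c j z) atTop
      (Metric.ball a (R / 2)) := by
  have hcirc : ∀ θ, circleMap a R θ ∈ G := fun θ => haG (circleMap_mem_closedBall a hR.le θ)
  have hcc : ∀ j, Continuous fun θ => c j (circleMap a R θ) := fun j =>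
    (hc j).continuousOn.comp_continuous (continuous_circleMap a R) hcirc
  set v : ℕ → Lp ℂ 2 angleMeasure := fun j =>
    (memLp_angleMeasure (hcc j)).toLp fun θ => c j (circleMap a R θ) with hv
  obtain ⟨M, hM⟩ := (isCompact_closedBall a R).exists_bound_of_continuousOn (hVc.mono haG)
  have hvs : Summable fun j => ‖v j‖ ^ 2 := by
    refine summable_of_sum_range_le (c := 2 * Real.pi * M) (fun j => sq_nonneg _) fun n => ?_
    have hi : ∀ j ∈ Finset.range n, Integrable (fun θ => ‖c j (circleMap a R θ)‖ ^ 2) angleMeasure :=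
      fun j _ => (memLp_angleMeasure (hcc j)).integrable_norm_pow (by simp)
    simp_rw [hv, norm_sq_toLp_angleMeasure]
    rw [← integral_finsetSum _ hi]
    calc ∫ θ, ∑ j ∈ Finset.range n, ‖c j (circleMap a R θ)‖ ^ 2 ∂angleMeasure
        ≤ ∫ _, M ∂angleMeasure := by
          refine integral_mono (integrable_finsetSum _ hi) (integrable_const _) fun θ => ?_
          refine (sum_le_hasSum _ (fun j _ => sq_nonneg _) (hV _ (hcirc θ))).trans ?_
          exact (le_abs_self _).trans (hM _ (circleMap_mem_closedBall a hR.le θ))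
      _ = 2 * Real.pi * M := by simp [Real.pi_pos.le]
  filter_upwards [ae_cauchySeq_vectorPartialSum hX hXi hX2 hX0 hX1 v hvs] with ω hω
  have hrep : ∀ n, ((vectorPartialSum X v n ω : Lp ℂ 2 angleMeasure) : ℝ → ℂ) =ᵐ[angleMeasure]
      fun θ => ∑ j ∈ Finset.range n, X j ω * c j (circleMap a R θ) := by
    intro n
    have h1 := Lp.coeFn_finsetSum (Finset.range n) fun j => X j ω • v j
    have h2 : ∀ᵐ θ ∂angleMeasure, ∀ j, (X j ω • v j : Lp ℂ 2 angleMeasure) θ =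
        X j ω * c j (circleMap a R θ) := by
      refine ae_all_iff.2 fun j => ?_
      filter_upwards [Lp.coeFn_smul (X j ω) (v j), (memLp_angleMeasure (hcc j)).coeFn_toLp]
        with θ h3 h4
      rw [h3, Pi.smul_apply, smul_eq_mul, hv, h4]
    filter_upwards [h1, h2] with θ h1 h2
    rw [vectorPartialSum, h1, Finset.sum_apply]
    exact Finset.sum_congr rfl fun j _ => h2 j
  have hbound : ∀ m n, ∀ z ∈ Metric.ball a (R / 2),
      dist (∑ j ∈ Finset.range m, X j ω * c j z) (∑ j ∈ Finset.range n, X j ω * c j z) ≤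
        √(2 * Real.pi) * dist (vectorPartialSum X v m ω) (vectorPartialSum X v n ω) := by
    intro m n z hz
    rw [dist_eq_norm, dist_eq_norm]
    refine le_trans ?_ (integral_norm_le_sqrt_mul_norm_Lp _)
    have hd : DiffContOnCl ℂ (fun z => ∑ j ∈ Finset.range m, X j ω * c j z -
        ∑ j ∈ Finset.range n, X j ω * c j z) (Metric.ball a R) := by
      refine DifferentiableOn.diffContOnCl ?_
      rw [closure_ball a hR.ne']
      have : ∀ n, DifferentiableOn ℂ (fun z => ∑ j ∈ Finset.range n, X j ω * c j z) G := fun n =>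
        DifferentiableOn.fun_sum fun j _ => (hc j).const_mul _
      exact ((this m).sub (this n)).mono haG
    refine (norm_le_integral_norm_circleMap hR hd hz).trans_eq ?_
    refine integral_congr_ae ?_
    filter_upwards [hrep m, hrep n, Lp.coeFn_sub (vectorPartialSum X v m ω)
      (vectorPartialSum X v n ω)] with θ h1 h2 h3
    rw [h3, Pi.sub_apply, h1, h2]
  rw [Metric.uniformCauchySeqOn_iff]
  intro ε hε
  have hs : 0 < √(2 * Real.pi) := Real.sqrt_pos.2 Real.two_pi_pos
  obtain ⟨N, hN⟩ := Metric.cauchySeq_iff.1 hω (ε / √(2 * Real.pi)) (by positivity)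
  refine ⟨N, fun m hm n hn z hz => (hbound m n z hz).trans_lt ?_⟩
  rw [← lt_div_iff₀' hs]
  exact hN m hm n hn

/-- A Gaussian-type random series of analytic functions with locally bounded variance converges
almost surely locally uniformly. -/
theorem ae_tendstoLocallyUniformlyOn (hG : IsOpen G) (hX : ∀ j, StronglyMeasurable (X j))
    (hXi : iIndepFun X P) (hX2 : ∀ j, MemLp (X j) 2 P) (hX0 : ∀ j, ∫ ω, X j ω ∂P = 0)
    (hX1 : ∀ j, ∫ ω, ‖X j ω‖ ^ 2 ∂P ≤ 1)
    (hc : ∀ j, DifferentiableOn ℂ (c j) G)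
    (hV : ∀ z ∈ G, HasSum (fun j => ‖c j z‖ ^ 2) (V z)) (hVc : ContinuousOn V G) :
    ∀ᵐ ω ∂P, TendstoLocallyUniformlyOn (fun n z => ∑ j ∈ Finset.range n, X j ω * c j z)
      (fun z => limUnder atTop fun n => ∑ j ∈ Finset.range n, X j ω * c j z) atTop G := by
  have hball : ∀ z ∈ G, ∃ R > 0, Metric.closedBall z R ⊆ G := fun z hz =>
    Metric.nhds_basis_closedBall.mem_iff.1 (hG.mem_nhds hz)
  choose! R hR hRG using hball
  -- Countably many half-size balls cover G, so the exceptional null sets can be united.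
  obtain ⟨t, htG, htc, hcov⟩ := TopologicalSpace.countable_cover_nhdsWithin
    (f := fun z => Metric.ball z (R z / 2)) (s := G)
    fun z hz => mem_nhdsWithin_of_mem_nhds (Metric.ball_mem_nhds z (half_pos (hR z hz)))
  have hall := (ae_ball_iff htc).2 fun z hz => ae_uniformCauchySeqOn_ball hX hXi hX2 hX0 hX1 hc hV hVc
    (hR z (htG hz)) (hRG z (htG hz))
  filter_upwards [hall] with ω hω
  have hlim : ∀ z ∈ G, Tendsto (fun n => ∑ j ∈ Finset.range n, X j ω * c j z) atTop
      (𝓝 (limUnder atTop fun n => ∑ j ∈ Finset.range n, X j ω * c j z)) := by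
    intro z hz
    obtain ⟨a, ha, hza⟩ := Set.mem_iUnion₂.1 (hcov hz)
    exact ((hω a ha).cauchySeq hza).tendsto_limUnder
  intro u hu z hz
  obtain ⟨a, ha, hza⟩ := Set.mem_iUnion₂.1 (hcov hz)
  refine ⟨Metric.ball a (R a / 2), mem_nhdsWithin_of_mem_nhds (Metric.isOpen_ball.mem_nhds hza), ?_⟩
  refine (hω a ha).tendstoUniformlyOn_of_tendsto (fun w hw => hlim w ?_) u hu
  exact hRG a (htG ha) (Metric.ball_subset_closedBall
    (Metric.ball_subset_ball (half_le_self (hR a (htG ha)).le) hw))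

end LocallyUniform

/-! ### Mean and large deviations of linear statistics of the zeros. -/

section Deviation

variable {Ω : Type*} [MeasurableSpace Ω]

/-- A jointly measurable random analytic function in `G` whose value at `z` is a centred complex
Gaussian variable of variance `V z`. -/
structure IsGaussianAnalyticFunction (P : Measure Ω) (G : Set ℂ) (F : Ω → ℂ → ℂ) (V : ℂ → ℝ) :
    Prop where
  isOpen : IsOpen G
  isConnected : IsConnected G
  measurable : Measurable (Function.uncurry F)
  analytic : ∀ ω, AnalyticOnNhd ℂ (F ω) G
  ne_zero : ∀ ω, ∃ z ∈ G, F ω z ≠ 0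
  measurable_variance : Measurable V
  variance_pos : ∀ᵐ z, z ∈ G → 0 < V z
  integrableOn_log_variance : ∀ K ⊆ G, IsCompact K → IntegrableOn (fun z => Real.log (V z)) K
  law : ∀ z ∈ G, P.map (fun ω => F ω z) = stdComplexGaussian.map fun ζ => √(V z) • ζ

namespace IsGaussianAnalyticFunction

variable {P : Measure Ω} [IsProbabilityMeasure P] {G : Set ℂ} {F : Ω → ℂ → ℂ} {V : ℂ → ℝ}
  {E : Type*} [NormedAddCommGroup E] [NormedSpace ℝ E]

/-- The logarithm of the modulus of the normalized function. -/
noncomputable def logNormalized (F : Ω → ℂ → ℂ) (V : ℂ → ℝ) (ω : Ω) (z : ℂ) : ℝ := Real.log (‖F ω z‖ / √(V z))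

section

variable (h : IsGaussianAnalyticFunction P G F V)
include h

omit [IsProbabilityMeasure P] in
lemma order_ne_top (ω : Ω) : ∀ z ∈ G, analyticOrderAt (F ω) z ≠ ⊤ := fun _ hz =>
  analyticOrderAt_ne_top_of_preconnected h.isConnected.isPreconnected (h.analytic ω) (h.ne_zero ω) hz

omit [IsProbabilityMeasure P] in
lemma measurable_logNormalized : Measurable (Function.uncurry (logNormalized F V)) :=
  Real.measurable_log.comp
    (h.measurable.norm.div (h.measurable_variance.comp measurable_snd).sqrt)

-- The splitting fails only where F ω or V vanishes and the logarithm takes its default value; such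
-- points of G form a null set.
omit [IsProbabilityMeasure P] in
lemma ae_logNormalized_eq (ω : Ω) :
    ∀ᵐ z, z ∈ G → logNormalized F V ω z = Real.log ‖F ω z‖ - 1 / 2 * Real.log (V z) := by
  obtain ⟨a, ha, hFa⟩ := h.ne_zero ω
  have h1 := ae_restrict_le_codiscreteWithin (μ := volume) h.isOpen.measurableSet
    ((h.analytic ω).preimage_zero_mem_codiscreteWithin hFa ha h.isConnected)
  have h2 := (ae_restrict_iff' h.isOpen.measurableSet).1 h1
  filter_upwards [h2, h.variance_pos] with z hz hV hzG
  have h3 : F ω z ≠ 0 := hz hzG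
  rw [logNormalized, Real.log_div (norm_ne_zero_iff.2 h3) (Real.sqrt_pos.2 (hV hzG)).ne',
    Real.log_sqrt (hV hzG).le]
  ring

omit [IsProbabilityMeasure P] in
lemma measurable_apply (z : ℂ) : Measurable fun ω => F ω z :=
  h.measurable.comp measurable_prodMk_right

-- Normalizing cancels the scale √V(z). That the law is free of z makes the mean constant and the
-- exponential moment uniform.
omit [IsProbabilityMeasure P] in
lemma map_logNormalized {z : ℂ} (hz : z ∈ G) (hV : 0 < V z) :
    P.map (fun ω => logNormalized F V ω z) = stdComplexGaussian.map fun ζ => Real.log ‖ζ‖ := by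
  have e : (fun ω => logNormalized F V ω z) =
      (fun w : ℂ => Real.log (‖w‖ / √(V z))) ∘ fun ω => F ω z := rfl
  rw [e, ← Measure.map_map (by fun_prop) (h.measurable_apply z), h.law z hz,
    Measure.map_map (by fun_prop) (by fun_prop)]
  congr 1 with ζ
  have hs : 0 < √(V z) := Real.sqrt_pos.2 hV
  rw [Function.comp_apply, norm_smul, Real.norm_of_nonneg hs.le, mul_div_cancel_left₀ _ hs.ne']

omit [IsProbabilityMeasure P] in
lemma lintegral_exp_abs_logNormalized_le {z : ℂ} (hz : z ∈ G) (hV : 0 < V z) :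
    ∫⁻ ω, ENNReal.ofReal (Real.exp |logNormalized F V ω z|) ∂P ≤ 3 := by
  have hm : Measurable fun x : ℝ => ENNReal.ofReal (Real.exp |x|) := by fun_prop
  have hL : Measurable fun ω => logNormalized F V ω z :=
    h.measurable_logNormalized.comp measurable_prodMk_right
  calc ∫⁻ ω, ENNReal.ofReal (Real.exp |logNormalized F V ω z|) ∂P
      = ∫⁻ x, ENNReal.ofReal (Real.exp |x|) ∂(P.map fun ω => logNormalized F V ω z) :=
        (lintegral_map hm hL).symm
    _ = ∫⁻ ζ, ENNReal.ofReal (Real.exp |Real.log ‖ζ‖|) ∂stdComplexGaussian := by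
        rw [h.map_logNormalized hz hV, lintegral_map hm (by fun_prop)]
    _ ≤ 3 := integral_exp_abs_log_norm_stdComplexGaussian_le

omit [IsProbabilityMeasure P] in
lemma integral_logNormalized {z : ℂ} (hz : z ∈ G) (hV : 0 < V z) :
    ∫ ω, logNormalized F V ω z ∂P = ∫ ζ, Real.log ‖ζ‖ ∂stdComplexGaussian := by
  have hL : Measurable fun ω => logNormalized F V ω z :=
    h.measurable_logNormalized.comp measurable_prodMk_right
  rw [← integral_map (f := fun x : ℝ => x) hL.aemeasurable (by fun_prop), h.map_logNormalized hz hV,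
    integral_map (by fun_prop) (by fun_prop)]

variable {φ : ℂ → E} (hφ : ContDiff ℝ (⊤ : ℕ∞) φ) (hφc : HasCompactSupport φ)
  (hφG : tsupport φ ⊆ G)

omit h [IsProbabilityMeasure P] in
include hφG in
lemma laplacian_eq_zero {z : ℂ} (hz : z ∉ G) : Δ φ z = 0 :=
  image_eq_zero_of_notMem_tsupport fun h' => hz (hφG (tsupport_laplacian_subset φ h'))

include hφ hφc hφG

/-- Tonelli reduces this to the exponential moment at a fixed z. It is used twice: for integrability
on the product, through |x| ≤ e^|x|, and as the input to Markov's inequality. -/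
lemma lintegral_lintegral_exp_le :
    ∫⁻ ω, (∫⁻ z, ENNReal.ofReal (‖Δ φ z‖ * Real.exp |logNormalized F V ω z|)) ∂P ≤
      3 * ENNReal.ofReal (∫ z, ‖Δ φ z‖) := by
  have hΔ : Continuous (Δ φ) := (contDiff_infty.1 hφ 2).continuous_laplacian
  have hint : Integrable fun z => ‖Δ φ z‖ := (hΔ.integrable_of_hasCompactSupport hφc.laplacian).norm
  have hm : Measurable (Function.uncurry fun ω z =>
      ENNReal.ofReal (‖Δ φ z‖ * Real.exp |logNormalized F V ω z|)) := by
    have h1 : Measurable fun p : Ω × ℂ => ‖Δ φ p.2‖ := hΔ.norm.measurable.comp measurable_snd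
    have h2 := h.measurable_logNormalized
    exact (h1.mul (Real.measurable_exp.comp (h2.abs))).ennreal_ofReal
  rw [lintegral_lintegral_swap hm.aemeasurable, ofReal_integral_eq_lintegral_ofReal hint
    (Eventually.of_forall fun z => norm_nonneg _), ← lintegral_const_mul' _ _ (by simp)]
  refine lintegral_mono_ae ?_
  filter_upwards [h.variance_pos] with z hV
  by_cases hz : z ∈ G
  · simp_rw [ENNReal.ofReal_mul (norm_nonneg (Δ φ z))]
    rw [lintegral_const_mul' _ _ (by simp), mul_comm]
    gcongr
    exact h.lintegral_exp_abs_logNormalized_le hz (hV hz)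
  · simp [laplacian_eq_zero hφG hz]

lemma integrable_prod_logNormalized_smul :
    Integrable (fun p : Ω × ℂ => logNormalized F V p.1 p.2 • Δ φ p.2) (P.prod volume) := by
  have hΔ : Continuous (Δ φ) := (contDiff_infty.1 hφ 2).continuous_laplacian
  have hsm : StronglyMeasurable fun p : Ω × ℂ => logNormalized F V p.1 p.2 • Δ φ p.2 :=
    h.measurable_logNormalized.stronglyMeasurable.smul
      (hΔ.stronglyMeasurable.comp_measurable measurable_snd)
  refine ⟨hsm.aestronglyMeasurable, ?_⟩
  rw [HasFiniteIntegral, lintegral_prod _ hsm.enorm.aemeasurable]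
  refine lt_of_le_of_lt ?_ ((h.lintegral_lintegral_exp_le hφ hφc hφG).trans_lt
    (ENNReal.mul_lt_top (by simp) ENNReal.ofReal_lt_top))
  refine lintegral_mono fun ω => lintegral_mono fun z => ?_
  rw [← ofReal_norm, norm_smul, mul_comm]
  refine ENNReal.ofReal_le_ofReal (mul_le_mul_of_nonneg_left ?_ (norm_nonneg _))
  rw [Real.norm_eq_abs]
  linarith [Real.add_one_le_exp |logNormalized F V ω z|]

omit [IsProbabilityMeasure P] in
lemma integrable_log_variance_smul : Integrable fun z => Real.log (V z) • Δ φ z := by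
  have hΔ : Continuous (Δ φ) := (contDiff_infty.1 hφ 2).continuous_laplacian
  rw [← integrableOn_iff_integrable_of_support_subset (s := tsupport φ)]
  · exact (h.integrableOn_log_variance _ hφG hφc).smul_continuousOn hΔ.continuousOn hφc
  · intro z hz
    by_contra hzn
    refine hz ?_
    beta_reduce
    rw [image_eq_zero_of_notMem_tsupport fun h' => hzn (tsupport_laplacian_subset φ h'), smul_zero]

omit [IsProbabilityMeasure P] in
lemma integrable_and_integral_zeroMeasure_eq [CompleteSpace E] (ω : Ω) :
    Integrable (fun z => logNormalized F V ω z • Δ φ z) ∧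
    ∫ z, φ z ∂(zeroMeasure G (F ω)) = (2 * Real.pi)⁻¹ •
      ((∫ z, logNormalized F V ω z • Δ φ z) + (1 / 2 : ℝ) • ∫ z, Real.log (V z) • Δ φ z) := by
  obtain ⟨h1, h2⟩ := integrable_and_integral_log_norm_smul_laplacian hφ hφc hφG (h.analytic ω)
    (h.order_ne_top ω)
  have h3 := h.integrable_log_variance_smul hφ hφc hφG
  have hae : (fun z => logNormalized F V ω z • Δ φ z) =ᵐ[volume]
      fun z => Real.log ‖F ω z‖ • Δ φ z - (1 / 2 : ℝ) • Real.log (V z) • Δ φ z := by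
    filter_upwards [h.ae_logNormalized_eq ω] with z hz
    by_cases hzG : z ∈ G
    · rw [hz hzG, sub_smul, mul_smul]
    · simp [laplacian_eq_zero hφG hzG]
  have h4 : Integrable fun z => (1 / 2 : ℝ) • Real.log (V z) • Δ φ z := h3.smul (1 / 2 : ℝ)
  refine ⟨(h1.sub h4).congr hae.symm, ?_⟩
  rw [integral_congr_ae hae, integral_sub h1 h4, integral_smul, sub_add_cancel, h2,
    inv_smul_smul₀ Real.two_pi_pos.ne']

omit h hφG [IsProbabilityMeasure P] in
lemma integral_laplacian_eq_zero : ∫ z, Δ φ z = 0 := by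
  have := integral_smul_laplacian_of_analyticAt (u := fun _ => 1) hφ hφc fun z _ => analyticAt_const
  simpa using this

/-- The Edelman–Kostlan formula in weak form: the normalized part has constant mean, which is killed
by ∫Δφ = 0. -/
lemma integrable_and_integral_integral_zeroMeasure [CompleteSpace E] :
    Integrable (fun ω => ∫ z, φ z ∂(zeroMeasure G (F ω))) P ∧
    ∫ ω, (∫ z, φ z ∂(zeroMeasure G (F ω))) ∂P = (2 * Real.pi)⁻¹ •
      ((1 / 2 : ℝ) • ∫ z, Real.log (V z) • Δ φ z) := by
  have hp := h.integrable_prod_logNormalized_smul hφ hφc hφG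
  have h1 : Integrable (fun ω => ∫ z, logNormalized F V ω z • Δ φ z) P := hp.integral_prod_left
  simp_rw [fun ω => (h.integrable_and_integral_zeroMeasure_eq hφ hφc hφG ω).2]
  refine ⟨(h1.add (integrable_const _)).smul _, ?_⟩
  rw [integral_smul, integral_add h1 (integrable_const _), integral_const, probReal_univ, one_smul,
    integral_integral_swap hp]
  have h2 : ∫ z, (∫ ω, logNormalized F V ω z • Δ φ z ∂P) =
      ∫ z, (∫ ζ, Real.log ‖ζ‖ ∂stdComplexGaussian) • Δ φ z := by
    refine integral_congr_ae ?_
    filter_upwards [h.variance_pos] with z hV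
    by_cases hz : z ∈ G
    · rw [integral_smul_const, h.integral_logNormalized hz (hV hz)]
    · simp [laplacian_eq_zero hφG hz]
  rw [h2, integral_smul, integral_laplacian_eq_zero hφ hφc, smul_zero, zero_add]

omit hφ [NormedSpace ℝ E] in
/-- Test functions are integrable with respect to the mean zero measure. -/
lemma integrable_meanMeasure (hφm : Continuous φ) :
    Integrable φ (meanMeasure P fun ω => zeroMeasure G (F ω)) := by
  have hn : Measurable fun ω => zeroMeasure G (F ω) :=
    measurable_zeroMeasure h.isOpen h.measurable h.analytic h.order_ne_top
  -- Since |φ| ≤ Cχ with χ smooth, the known integrability of the statistic of χ suffices, and φ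
  -- need only be continuous.
  obtain ⟨χ, hχ, hχc, hχG, hχ1, hχ01⟩ := exists_cutoff hφc h.isOpen hφG
  obtain ⟨C, hC⟩ := hφc.exists_bound_of_continuous hφm
  have hC0 : 0 ≤ C := (norm_nonneg _).trans (hC 0)
  have hle : ∀ z, ‖φ z‖ₑ ≤ ENNReal.ofReal C * ENNReal.ofReal (χ z) := by
    intro z
    by_cases hz : z ∈ tsupport φ
    · rw [(eventually_nhdsSet_iff_forall.1 hχ1 z hz).self_of_nhds, ENNReal.ofReal_one, mul_one,
        ← ofReal_norm]
      exact ENNReal.ofReal_le_ofReal (hC z)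
    · rw [image_eq_zero_of_notMem_tsupport hz]
      simp
  refine ⟨hφm.aestronglyMeasurable, ?_⟩
  rw [HasFiniteIntegral, meanMeasure,
    Measure.lintegral_bind hn.aemeasurable hφm.enorm.measurable.aemeasurable]
  have hint := (h.integrable_and_integral_integral_zeroMeasure hχ hχc hχG).1
  calc ∫⁻ ω, (∫⁻ z, ‖φ z‖ₑ ∂(zeroMeasure G (F ω))) ∂P
      ≤ ∫⁻ ω, ENNReal.ofReal C * ‖∫ z, χ z ∂(zeroMeasure G (F ω))‖ₑ ∂P := by
        refine lintegral_mono fun ω => ?_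
        have h1 := ofReal_integral_eq_lintegral_ofReal (integrable_zeroMeasure hχ.continuous hχc hχG
          (h.analytic ω) (h.order_ne_top ω)) (Eventually.of_forall fun z => (hχ01 z).1)
        have h2 : 0 ≤ ∫ z, χ z ∂(zeroMeasure G (F ω)) := integral_nonneg fun z => (hχ01 z).1
        rw [Real.enorm_of_nonneg h2, h1, ← lintegral_const_mul' _ _ ENNReal.ofReal_ne_top]
        exact lintegral_mono hle
    _ = ENNReal.ofReal C * ∫⁻ ω, ‖∫ z, χ z ∂(zeroMeasure G (F ω))‖ₑ ∂P :=
        lintegral_const_mul' _ _ ENNReal.ofReal_ne_top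
    _ < ⊤ := ENNReal.mul_lt_top ENNReal.ofReal_lt_top hint.2

/-- The fluctuation of a linear statistic of the zeros. -/
lemma integral_zeroMeasure_sub_integral_meanMeasure [CompleteSpace E] (ω : Ω) :
    ∫ z, φ z ∂(zeroMeasure G (F ω)) - ∫ z, φ z ∂(meanMeasure P fun ω => zeroMeasure G (F ω)) =
      (2 * Real.pi)⁻¹ • ∫ z, logNormalized F V ω z • Δ φ z := by
  have hn : Measurable fun ω => zeroMeasure G (F ω) :=
    measurable_zeroMeasure h.isOpen h.measurable h.analytic h.order_ne_top
  have hmean : ∫ z, φ z ∂(meanMeasure P fun ω => zeroMeasure G (F ω)) =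
      ∫ ω, (∫ z, φ z ∂(zeroMeasure G (F ω))) ∂P := by
    have hi := h.integrable_meanMeasure hφc hφG hφ.continuous
    -- Seen as a kernel composition, the mean measure allows the order of integration to be
    -- exchanged.
    set κ : Kernel Ω ℂ := ⟨fun ω => zeroMeasure G (F ω), hn⟩ with hκ
    have e : meanMeasure P (fun ω => zeroMeasure G (F ω)) = (κ ∘ₖ Kernel.const Unit P) () :=
      Measure.comp_eq_comp_const_apply (κ := κ)
    rw [e] at hi ⊢
    rw [Kernel.integral_comp hi]
    rfl
  rw [hmean, (h.integrable_and_integral_integral_zeroMeasure hφ hφc hφG).2,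
    (h.integrable_and_integral_zeroMeasure_eq hφ hφc hφG ω).2, ← smul_sub, add_sub_cancel_right]

/-- **Offord's large-deviation estimate** for zeros of Gaussian analytic functions. -/
theorem measureReal_le_norm_sub_le [CompleteSpace E] (lam : ℝ) :
    P.real {ω | lam ≤ ‖∫ z, φ z ∂(zeroMeasure G (F ω)) -
      ∫ z, φ z ∂(meanMeasure P fun ω => zeroMeasure G (F ω))‖} ≤
      3 * Real.exp (-(2 * Real.pi * lam) / ∫ z, ‖Δ φ z‖) := by
  have hΔ : Continuous (Δ φ) := (contDiff_infty.1 hφ 2).continuous_laplacian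
  have hw : Integrable fun z => ‖Δ φ z‖ := (hΔ.integrable_of_hasCompactSupport hφc.laplacian).norm
  set M := ∫ z, ‖Δ φ z‖ with hM
  have hM0 : 0 ≤ M := integral_nonneg fun z => norm_nonneg _
  -- When M = 0, division by zero gives exponent 0 and the trivial bound 3.
  rcases hM0.eq_or_lt with hM0 | hMpos
  · rw [← hM0, div_zero, Real.exp_zero]
    exact measureReal_le_one.trans (by norm_num)
  set a := 2 * Real.pi * lam / M with ha
  set I : Ω → ℝ≥0∞ := fun ω =>
    ∫⁻ z, ENNReal.ofReal (‖Δ φ z‖ * Real.exp |logNormalized F V ω z|) with hI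
  have hIm : Measurable I := by
    refine Measurable.lintegral_prod_right' (f := fun p : Ω × ℂ =>
      ENNReal.ofReal (‖Δ φ p.2‖ * Real.exp |logNormalized F V p.1 p.2|)) ?_
    have h1 : Measurable fun p : Ω × ℂ => ‖Δ φ p.2‖ := hΔ.norm.measurable.comp measurable_snd
    exact (h1.mul (Real.measurable_exp.comp h.measurable_logNormalized.abs)).ennreal_ofReal
  have hsub : {ω | lam ≤ ‖∫ z, φ z ∂(zeroMeasure G (F ω)) -
      ∫ z, φ z ∂(meanMeasure P fun ω => zeroMeasure G (F ω))‖} ⊆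
      {ω | ENNReal.ofReal (M * Real.exp a) ≤ I ω} := by
    intro ω hω
    simp only [Set.mem_ofPred_eq] at hω ⊢
    rw [h.integral_zeroMeasure_sub_integral_meanMeasure hφ hφc hφG ω, norm_smul,
      Real.norm_of_nonneg (by positivity), le_inv_mul_iff₀ Real.two_pi_pos] at hω
    have hLi := (h.integrable_and_integral_zeroMeasure_eq hφ hφc hφG ω).1.norm
    have hJ : 2 * Real.pi * lam ≤ ∫ z, ‖logNormalized F V ω z • Δ φ z‖ :=
      hω.trans (norm_integral_le_integral_norm _)
    -- |Δφ| times the tangent line of exp at a, evaluated at |L|. This is Jensen's inequality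
    -- unfolded, and it does not require I ω to be finite.
    set g : ℂ → ℝ := fun z =>
      Real.exp a * ((1 - a) * ‖Δ φ z‖ + ‖logNormalized F V ω z • Δ φ z‖) with hg
    have hgi : Integrable g := ((hw.const_mul (1 - a)).add hLi).const_mul (Real.exp a)
    have hgint : M * Real.exp a ≤ ∫ z, g z := by
      rw [hg, integral_const_mul, integral_add (hw.const_mul _) hLi, integral_const_mul, ← hM,
        mul_comm]
      refine mul_le_mul_of_nonneg_left ?_ (Real.exp_pos a).le
      have : a * M = 2 * Real.pi * lam := div_mul_cancel₀ _ hMpos.ne'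
      linarith
    have hpt : ∀ z, g z ≤ ‖Δ φ z‖ * Real.exp |logNormalized F V ω z| := by
      intro z
      have h1 := Real.add_one_le_exp (|logNormalized F V ω z| - a)
      have h2 : Real.exp |logNormalized F V ω z| =
          Real.exp a * Real.exp (|logNormalized F V ω z| - a) := by
        rw [← Real.exp_add]
        congr 1
        ring
      have h3 : g z = ‖Δ φ z‖ * (Real.exp a * (|logNormalized F V ω z| - a + 1)) := by
        rw [hg]
        beta_reduce
        rw [norm_smul, Real.norm_eq_abs]
        ring
      rw [h3, h2]
      gcongr
    calc ENNReal.ofReal (M * Real.exp a) ≤ ENNReal.ofReal (∫ z, g z) :=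
          ENNReal.ofReal_le_ofReal hgint
      _ ≤ ∫⁻ z, ENNReal.ofReal (g z) := by
          rw [integral_eq_lintegral_pos_part_sub_lintegral_neg_part hgi]
          refine (ENNReal.ofReal_le_ofReal (sub_le_self _ ENNReal.toReal_nonneg)).trans ?_
          exact ENNReal.ofReal_toReal_le
      _ ≤ I ω := lintegral_mono fun z => ENNReal.ofReal_le_ofReal (hpt z)
  have hmarkov := mul_meas_ge_le_lintegral (μ := P) hIm (ENNReal.ofReal (M * Real.exp a))
  have hbound := hmarkov.trans (h.lintegral_lintegral_exp_le hφ hφc hφG)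
  have hMe : 0 < M * Real.exp a := by positivity
  have hreal : (M * Real.exp a) * P.real {ω | ENNReal.ofReal (M * Real.exp a) ≤ I ω} ≤ 3 * M := by
    have := ENNReal.toReal_mono (by finiteness) hbound
    rw [ENNReal.toReal_mul, ENNReal.toReal_mul, ENNReal.toReal_ofReal hMe.le,
      ENNReal.toReal_ofReal hMpos.le] at this
    simpa [Measure.real] using this
  refine (measureReal_mono hsub).trans ?_
  rw [neg_div, ← ha, Real.exp_neg, ← div_eq_mul_inv, le_div_iff₀ (Real.exp_pos a)]
  nlinarith [hreal]

end

end IsGaussianAnalyticFunction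

end Deviation

/-! ### A version of the Gaussian series that is analytic and nonzero for every ω. -/

section Construction

variable {Ω : Type*} [MeasurableSpace Ω] {P : Measure Ω} [IsProbabilityMeasure P]
  {X : ℕ → Ω → ℂ} {G : Set ℂ} {c : ℕ → ℂ → ℂ} {V : ℂ → ℝ}

/-- Green's formula already contains integrability against a Laplacian. The test function χu, with u
= ½ log(|z|² + 1), has a strictly positive continuous Laplacian on K, which can be divided out. -/
lemma integrableOn_log_norm_of_analyticOnNhd {f : ℂ → ℂ} (hG : IsOpen G)
    (hf : AnalyticOnNhd ℂ f G) (hord : ∀ z ∈ G, analyticOrderAt f z ≠ ⊤)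
    {K : Set ℂ} (hK : IsCompact K) (hKG : K ⊆ G) : IntegrableOn (fun z => Real.log ‖f z‖) K := by
  obtain ⟨χ, hχ, hχc, hχG, hχ1, -⟩ := exists_cutoff hK hG hKG
  set u : ℂ → ℝ := fun z => 1 / 2 * Real.log (‖z‖ ^ 2 + 1 ^ 2) with hu
  have hus : ContDiff ℝ (⊤ : ℕ∞) u :=
    contDiff_iff_contDiffAt.2 fun z => (analyticAt_half_log_sq one_pos z).contDiffAt
  have hi := (integrable_and_integral_log_norm_smul_laplacian (hχ.mul hus) hχc.mul_right
    ((tsupport_mul_subset_left).trans hχG) hf hord).1.integrableOn (s := K)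
  have hc : ContinuousOn (fun z : ℂ => (‖z‖ ^ 2 + 1) ^ 2 / 2) K := by fun_prop
  refine (hi.mul_continuousOn hc hK).congr_fun (fun z hz => ?_) hK.measurableSet
  have h1 : (fun z => χ z * u z) =ᶠ[𝓝 z] u := by
    filter_upwards [eventually_nhdsSet_iff_forall.1 hχ1 z hz] with w hw
    rw [hw, one_mul]
  have h2 : Δ (fun z => χ z * u z) z = 2 * 1 ^ 2 / (‖z‖ ^ 2 + 1 ^ 2) ^ 2 := by
    rw [(InnerProductSpace.laplacian_congr_nhds h1).eq_of_nhds, hu, laplacian_half_log_sq one_pos]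
  beta_reduce
  rw [h2, smul_eq_mul]
  field_simp

/-- One nonzero term suffices: 2 log|c j| ≤ log V ≤ V almost everywhere in G, and both outer
functions are integrable on compact subsets. -/
lemma integrableOn_log_variance (hG : IsOpen G) (hGc : IsConnected G)
    (hV : ∀ z, HasSum (fun j => ‖c j z‖ ^ 2) (V z)) (hVc : ContinuousOn V G)
    (hVm : Measurable V)
    (hc : ∀ j, DifferentiableOn ℂ (c j) G) (hne : ∃ j, ∃ z ∈ G, c j z ≠ 0) :
    (∀ᵐ z, z ∈ G → 0 < V z) ∧
      ∀ K ⊆ G, IsCompact K → IntegrableOn (fun z => Real.log (V z)) K := by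
  obtain ⟨j, a, ha, hja⟩ := hne
  have hana : AnalyticOnNhd ℂ (c j) G := (hc j).analyticOnNhd hG
  have hle : ∀ z, ‖c j z‖ ^ 2 ≤ V z := fun z => le_hasSum (hV z) j fun _ _ => sq_nonneg _
  have hae : ∀ᵐ z, z ∈ G → c j z ≠ 0 :=
    (ae_restrict_iff' hG.measurableSet).1 (ae_restrict_le_codiscreteWithin hG.measurableSet
      (hana.preimage_zero_mem_codiscreteWithin hja ha hGc))
  refine ⟨?_, fun K hKG hK => ?_⟩
  · filter_upwards [hae] with z hz hzG
    have := norm_pos_iff.2 (hz hzG)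
    exact lt_of_lt_of_le (by positivity) (hle z)
  · have hlog := integrableOn_log_norm_of_analyticOnNhd hG hana (fun z hz =>
      analyticOrderAt_ne_top_of_preconnected hGc.isPreconnected hana ⟨a, ha, hja⟩ hz) hK hKG
    have hVi : IntegrableOn V K := (hVc.mono hKG).integrableOn_compact hK
    refine Integrable.mono' (hVi.add (hlog.abs.const_mul 2))
      (Real.measurable_log.comp hVm).aestronglyMeasurable ?_
    filter_upwards [ae_restrict_of_ae hae, ae_restrict_mem hK.measurableSet] with z hz hzK
    have hpos := norm_pos_iff.2 (hz (hKG hzK))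
    have hVpos : 0 < V z := lt_of_lt_of_le (by positivity) (hle z)
    have h1 : Real.log (V z) ≤ V z := (Real.log_le_self hVpos.le)
    have h2 : 2 * Real.log ‖c j z‖ ≤ Real.log (V z) := by
      have := Real.log_le_log (by positivity) (hle z)
      rw [Real.log_pow] at this
      exact_mod_cast this
    have h3 := neg_abs_le (Real.log ‖c j z‖)
    have h4 := abs_nonneg (Real.log ‖c j z‖)
    simp only [Pi.add_apply]
    rw [Real.norm_eq_abs, abs_le]
    constructor <;> linarith

/-- An almost surely locally uniformly convergent Gaussian series of analytic functions has a
version which is a Gaussian analytic function. -/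
theorem exists_isGaussianAnalyticFunction (hG : IsOpen G) (hGc : IsConnected G)
    (hcm : ∀ j, Measurable (c j)) (hc : ∀ j, DifferentiableOn ℂ (c j) G)
    (hc0 : ∀ j, ∀ z ∉ G, c j z = 0)
    (hV : ∀ z, HasSum (fun j => ‖c j z‖ ^ 2) (V z)) (hVc : ContinuousOn V G)
    (hne : ∃ j, ∃ z ∈ G, c j z ≠ 0)
    (hXm : ∀ j, Measurable (X j)) (hXi : iIndepFun X P)
    (hlaw : ∀ j, P.map (X j) = stdComplexGaussian ∨ X j = 0 ∧ c j = 0) :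
    (∀ᵐ ω ∂P, TendstoLocallyUniformlyOn (fun n z => ∑ j ∈ Finset.range n, X j ω * c j z)
      (fun z => limUnder atTop fun n => ∑ j ∈ Finset.range n, X j ω * c j z) atTop G) ∧
    ∃ F : Ω → ℂ → ℂ, IsGaussianAnalyticFunction P G F V ∧
      ∀ᵐ ω ∂P, F ω = fun z => limUnder atTop fun n => ∑ j ∈ Finset.range n, X j ω * c j z := by
  have hX2 : ∀ j, MemLp (X j) 2 P := fun j => by
    rcases hlaw j with h | h
    · have := memLp_id_stdComplexGaussian
      rw [← h] at this
      exact this.comp_of_map (hXm j).aemeasurable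
    · rw [h.1]
      exact MemLp.zero
  have hX0 : ∀ j, ∫ ω, X j ω ∂P = 0 := fun j => by
    rcases hlaw j with h | h
    · rw [← integral_map (f := fun z : ℂ => z) (hXm j).aemeasurable (by fun_prop), h,
        integral_id_stdComplexGaussian]
    · simp [h.1]
  have hX1 : ∀ j, ∫ ω, ‖X j ω‖ ^ 2 ∂P ≤ 1 := fun j => by
    rcases hlaw j with h | h
    · rw [← integral_map (f := fun z : ℂ => ‖z‖ ^ 2) (hXm j).aemeasurable (by fun_prop), h,
        integral_norm_sq_stdComplexGaussian]
    · simp [h.1]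
  have hconv := ae_tendstoLocallyUniformlyOn hG (fun j => (hXm j).stronglyMeasurable) hXi hX2 hX0 hX1
    hc (fun z _ => hV z) hVc
  refine ⟨hconv, ?_⟩
  set S : ℕ → Ω → ℂ → ℂ := fun n ω z => ∑ j ∈ Finset.range n, X j ω * c j z with hS
  set L : Ω → ℂ → ℂ := fun ω z => limUnder atTop fun n => S n ω z with hL
  have hVm : Measurable V := measurable_of_tendsto_metrizable
    (f := fun n z => ∑ j ∈ Finset.range n, ‖c j z‖ ^ 2)
    (fun n => Finset.measurable_fun_sum _ fun j _ => (hcm j).norm.pow_const 2)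
    (tendsto_pi_nhds.2 fun z => (hV z).tendsto_sum_nat)
  have hSm : ∀ n, Measurable (Function.uncurry (S n)) := fun n =>
    Finset.measurable_fun_sum _ fun j _ =>
      ((hXm j).comp measurable_fst).mul ((hcm j).comp measurable_snd)
  obtain ⟨hVpos, hVint⟩ := integrableOn_log_variance hG hGc hV hVc hVm hc hne
  obtain ⟨B, hB, hBm, hB0⟩ := exists_measurable_superset_of_null (ae_iff.1 hconv)
  have hgood : ∀ ω ∉ B, TendstoLocallyUniformlyOn (fun n => S n ω) (L ω) atTop G := by
    intro ω hω
    by_contra hcon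
    exact hω (hB hcon)
  have hBae : ∀ᵐ ω ∂P, ω ∉ B := measure_eq_zero_iff_ae_notMem.1 hB0
  -- All c j vanish off G, so the partial sums converge at every z; this makes F₁ below jointly
  -- measurable as a pointwise limit.
  have hlim : ∀ ω ∉ B, ∀ z, Tendsto (fun n => S n ω z) atTop (𝓝 (L ω z)) := by
    intro ω hω z
    by_cases hz : z ∈ G
    · exact (hgood ω hω).tendsto_at hz
    · have h0 : ∀ n, S n ω z = 0 := fun n => Finset.sum_eq_zero fun j _ => by rw [hc0 j z hz, mul_zero]
      have : L ω z = 0 := by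
        rw [hL]
        simp only [h0]
        exact tendsto_const_nhds.limUnder_eq
      rw [this]
      simp only [h0]
      exact tendsto_const_nhds
  classical
  set F₁ : Ω → ℂ → ℂ := fun ω z => if ω ∈ B then 1 else L ω z with hF₁
  have hF₁m : Measurable (Function.uncurry F₁) := by
    refine measurable_of_tendsto_metrizable
      (f := fun n (p : Ω × ℂ) => if p.1 ∈ B then 1 else S n p.1 p.2) (fun n => ?_) ?_
    · exact Measurable.ite (measurable_fst hBm) measurable_const (hSm n)
    · rw [tendsto_pi_nhds]
      rintro ⟨ω, z⟩
      by_cases hω : ω ∈ B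
      · simp only [hω, if_true, hF₁, Function.uncurry_apply_pair]
        exact tendsto_const_nhds
      · simp only [hω, if_false, hF₁, Function.uncurry_apply_pair]
        exact hlim ω hω z
  have hF₁z : ∀ z, Measurable fun ω => F₁ ω z := fun z => hF₁m.comp measurable_prodMk_right
  have hF₁ae : ∀ᵐ ω ∂P, F₁ ω = L ω := by
    filter_upwards [hBae] with ω hω
    funext z
    simp [hF₁, hω]
  have hF₁law : ∀ z, P.map (fun ω => F₁ ω z) = stdComplexGaussian.map fun ζ => √(V z) • ζ := by
    intro z
    refine map_tsum_gaussian (c := fun j => c j z) hXm hXi (fun j => ?_) (hV z) (hF₁z z) ?_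
    · exact (hlaw j).imp_right fun h => by rw [h.2]; rfl
    · filter_upwards [hBae, hF₁ae] with ω hω hω'
      rw [hω']
      exact hlim ω hω z
  have hF₁ana : ∀ ω, AnalyticOnNhd ℂ (F₁ ω) G := by
    intro ω
    by_cases hω : ω ∈ B
    · have : F₁ ω = fun _ => 1 := funext fun z => by simp [hF₁, hω]
      rw [this]
      exact analyticOnNhd_const
    · have : F₁ ω = L ω := funext fun z => by simp [hF₁, hω]
      rw [this]
      refine DifferentiableOn.analyticOnNhd ?_ hG
      exact (hgood ω hω).differentiableOn (Eventually.of_forall fun n =>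
        DifferentiableOn.fun_sum fun j _ => (hc j).const_mul _) hG
  obtain ⟨j₀, z₀, hz₀, hj₀⟩ := hne
  have hV₀ : 0 < V z₀ := by
    have := norm_pos_iff.2 hj₀
    exact lt_of_lt_of_le (by positivity) (le_hasSum (hV z₀) j₀ fun _ _ => sq_nonneg _)
  have hne₀ : ∀ᵐ ω ∂P, F₁ ω z₀ ≠ 0 := by
    have h1 : P.map (fun ω => F₁ ω z₀) {0} = 0 := by
      rw [hF₁law, Measure.map_apply (by fun_prop) (measurableSet_singleton 0)]
      have : (fun ζ : ℂ => √(V z₀) • ζ) ⁻¹' {0} = {0} := by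
        ext ζ
        simp [(Real.sqrt_pos.2 hV₀).ne']
      rw [this, stdComplexGaussian_singleton]
    rw [Measure.map_apply (hF₁z z₀) (measurableSet_singleton 0)] at h1
    rw [ae_iff]
    simpa [Set.preimage] using h1
  -- F₁ ω z₀ is a nondegenerate Gaussian, so this second change affects a null event only; it
  -- ensures F ω z₀ ≠ 0 for every ω.
  set F : Ω → ℂ → ℂ := fun ω z => if F₁ ω z₀ = 0 then 1 else F₁ ω z with hF
  have hFae : ∀ᵐ ω ∂P, F ω = F₁ ω := by
    filter_upwards [hne₀] with ω hω
    funext z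
    simp [hF, hω]
  refine ⟨F, ⟨hG, hGc, ?_, fun ω => ?_, fun ω => ⟨z₀, hz₀, ?_⟩, hVm, hVpos, hVint, fun z _ => ?_⟩, ?_⟩
  · exact Measurable.ite (((hF₁z z₀).comp measurable_fst) (measurableSet_singleton 0))
      measurable_const hF₁m
  · by_cases hω : F₁ ω z₀ = 0
    · have : F ω = fun _ => 1 := funext fun z => by simp [hF, hω]
      rw [this]
      exact analyticOnNhd_const
    · have : F ω = F₁ ω := funext fun z => by simp [hF, hω]
      rw [this]
      exact hF₁ana ω
  · by_cases hω : F₁ ω z₀ = 0 <;> simp [hF, hω]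
  · rw [← hF₁law z]
    refine Measure.map_congr ?_
    filter_upwards [hFae] with ω hω
    rw [hω]
  · filter_upwards [hFae, hF₁ae] with ω h1 h2
    rw [h1, h2]

end Construction

/-! ### Reduction of N ≤ ∞ to full sequences, and the theorem. -/

/-- Extending an independent family by zero keeps it independent. -/
lemma iIndepFun_of_subtype {Ω : Type*} [MeasurableSpace Ω] {P : Measure Ω} [IsProbabilityMeasure P]
    {p : ℕ → Prop} {Y : ℕ → Ω → ℂ} (hY : iIndepFun (fun j : {j // p j} => Y j) P)
    (h0 : ∀ j, ¬ p j → Y j = 0) : iIndepFun Y P := by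
  classical
  rw [iIndepFun_iff_measure_inter_preimage_eq_mul] at hY ⊢
  intro S sets hS
  -- A padding variable is identically 0, so its preimages are empty or everything: either both
  -- sides vanish or all padding factors drop out.
  by_cases hcase : ∃ j ∈ S, ¬ p j ∧ (0 : ℂ) ∉ sets j
  · obtain ⟨j, hj, hpj, hj0⟩ := hcase
    have he : Y j ⁻¹' sets j = ∅ := by
      rw [h0 j hpj]
      ext ω
      simpa using hj0
    rw [Finset.prod_eq_zero hj (by rw [he, measure_empty])]
    exact measure_mono_null (Set.iInter₂_subset j hj) (by rw [he, measure_empty])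
  · push Not at hcase
    have huniv : ∀ j ∈ S, ¬ p j → Y j ⁻¹' sets j = Set.univ := by
      intro j hj hpj
      rw [h0 j hpj]
      ext ω
      simpa using hcase j hj hpj
    have h1 := hY (S.subtype p) (sets := fun j => sets j) fun j hj => hS j (Finset.mem_subtype.1 hj)
    rw [Finset.prod_subtype_eq_prod_filter (fun j => P (Y j ⁻¹' sets j)), Finset.prod_filter] at h1
    rw [← Finset.prod_congr rfl (fun j hj => ?_), ← h1]
    · congr 1
      ext ω
      simp only [Set.mem_iInter, Finset.mem_subtype, Subtype.forall]
      constructor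
      · intro h j _ hj
        exact h j hj
      · intro h j hj
        by_cases hpj : p j
        · exact h j hpj hj
        · rw [huniv j hj hpj]
          trivial
    · by_cases hpj : p j
      · simp [hpj]
      · simp [hpj, huniv j hj hpj]

lemma hasSum_of_subtype {p : ℕ → Prop} {f : ℕ → ℝ} {g : {j // p j} → ℝ} {a : ℝ} (hg : HasSum g a)
    (hfg : ∀ j : {j // p j}, f j = g j) (hf : ∀ j, ¬ p j → f j = 0) : HasSum f a := by
  have hinj : Function.Injective (Subtype.val : {j : ℕ // p j} → ℕ) := Subtype.val_injective
  rw [← hinj.hasSum_iff fun j hj => hf j fun h => hj ⟨⟨j, h⟩, rfl⟩]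
  exact (funext hfg : f ∘ Subtype.val = g) ▸ hg

theorem theorem3 {Ω : Type*} [MeasurableSpace Ω] (P : Measure Ω) [IsProbabilityMeasure P]
    {𝕜 : Type*} [RCLike 𝕜]
    -- a plane domain and `N ≤ ∞` analytic functions in it, not all of them identically zero
    (G : Set ℂ) (hGo : IsOpen G) (hGc : IsConnected G)
    (N : ℕ∞) (ψ : ℕ → ℂ → ℂ)
    (hψ : ∀ j : ℕ, (j : ℕ∞) < N → DifferentiableOn ℂ (ψ j) G)
    (hψ_sum : SummableLocallyUniformlyOn
      (fun (j : {j : ℕ // (j : ℕ∞) < N}) (z : ℂ) => ‖ψ j z‖ ^ 2) G)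
    (hψ_ne : ∃ j : ℕ, (j : ℕ∞) < N ∧ ∃ z ∈ G, ψ j z ≠ 0)
    -- independent standard complex Gaussian coefficients
    (ξ : ℕ → Ω → ℂ)
    (hξ : ∀ j : ℕ, (j : ℕ∞) < N → HasLaw (ξ j) stdComplexGaussian P)
    (hξ_indep : iIndepFun (fun j : {j : ℕ // (j : ℕ∞) < N} => ξ j) P)
    -- a real- or complex-valued test function
    (φ : ℂ → 𝕜) (hφ : ContDiff ℝ ((⊤ : ℕ∞) : WithTop ℕ∞) φ) (hφc : HasCompactSupport φ) (hφG : tsupport φ ⊆ G) :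
    -- the random function, its zero measure, the mean measure and the integrals are well defined
    (∀ᵐ ω ∂P, TendstoLocallyUniformlyOn (fun n => gafPartialSum N ψ ξ n ω) (gaf N ψ ξ ω) atTop G) ∧
    AEMeasurable (gafZeros G N ψ ξ) P ∧
    (∀ᵐ ω ∂P, Integrable φ (gafZeros G N ψ ξ ω)) ∧
    Integrable φ (meanMeasure P (gafZeros G N ψ ξ)) ∧
    -- the large-deviation estimate
    ∀ lam : ℝ, 0 < lam →
      P.real {ω | lam ≤ ‖(∫ z, φ z ∂(gafZeros G N ψ ξ ω)) -
          ∫ z, φ z ∂(meanMeasure P (gafZeros G N ψ ξ))‖} ≤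
        3 * Real.exp (-(2 * Real.pi * lam) / ∫ z, ‖Δ φ z‖) := by
  classical
  -- Coefficient functions are extended by zero off G and beyond N. The ξ j are only almost
  -- everywhere measurable, so X uses measurable versions, again padded by zero.
  set c : ℕ → ℂ → ℂ := fun j => if (j : ℕ∞) < N then G.piecewise (ψ j) 0 else 0 with hcdef
  set X : ℕ → Ω → ℂ := fun j => if h : (j : ℕ∞) < N then (hξ j h).aemeasurable.mk (ξ j) else 0
    with hXdef
  have hcψ : ∀ j : ℕ, (j : ℕ∞) < N → ∀ z ∈ G, c j z = ψ j z := fun j hj z hz => by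
    simp [hcdef, hj, hz]
  have hXξ : ∀ᵐ ω ∂P, ∀ j : ℕ, (j : ℕ∞) < N → X j ω = ξ j ω := by
    refine ae_all_iff.2 fun j => ?_
    by_cases hj : (j : ℕ∞) < N
    · filter_upwards [(hξ j hj).aemeasurable.ae_eq_mk] with ω hω _
      simp [hXdef, hj, hω]
    · exact Eventually.of_forall fun ω h => absurd h hj
  have hXm : ∀ j, Measurable (X j) := fun j => by
    by_cases hj : (j : ℕ∞) < N
    · simp only [hXdef, hj, dite_true]
      exact (hξ j hj).aemeasurable.measurable_mk
    · simp only [hXdef, hj, dite_false]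
      exact measurable_const
  have hXi : iIndepFun X P := by
    refine iIndepFun_of_subtype (p := fun j : ℕ => (j : ℕ∞) < N) ?_ fun j hj => by simp [hXdef, hj]
    refine iIndepFun.congr (fun j => ?_) hξ_indep
    filter_upwards [hXξ] with ω hω
    exact (hω j j.2).symm
  have hlaw : ∀ j, P.map (X j) = stdComplexGaussian ∨ X j = 0 ∧ c j = 0 := fun j => by
    by_cases hj : (j : ℕ∞) < N
    · left
      rw [← (hξ j hj).map_eq]
      refine Measure.map_congr ?_
      filter_upwards [hXξ] with ω hω
      exact hω j hj
    · right
      simp [hXdef, hcdef, hj]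
  have hcm : ∀ j, Measurable (c j) := fun j => by
    by_cases hj : (j : ℕ∞) < N
    · simp only [hcdef, hj, if_true]
      exact (hψ j hj).continuousOn.measurable_piecewise continuousOn_const hGo.measurableSet
    · simp only [hcdef, hj, if_false]
      exact measurable_const
  have hc : ∀ j, DifferentiableOn ℂ (c j) G := fun j => by
    by_cases hj : (j : ℕ∞) < N
    · exact (hψ j hj).congr fun z hz => hcψ j hj z hz
    · simp only [hcdef, hj, if_false]
      exact differentiableOn_const 0
  have hc0 : ∀ j, ∀ z ∉ G, c j z = 0 := fun j z hz => by
    by_cases hj : (j : ℕ∞) < N <;> simp [hcdef, hj, hz]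
  have hsumG := hψ_sum.hasSumLocallyUniformlyOn
  have hVG : ∀ z ∈ G, HasSum (fun j => ‖c j z‖ ^ 2)
      (∑' j : {j : ℕ // (j : ℕ∞) < N}, ‖ψ j z‖ ^ 2) := by
    intro z hz
    refine hasSum_of_subtype (hsumG.hasSum hz) (fun j => ?_) fun j hj => ?_
    · rw [hcψ j j.2 z hz]
    · simp [hcdef, hj]
  set V : ℂ → ℝ := fun z => ∑' j, ‖c j z‖ ^ 2 with hVdef
  have hV : ∀ z, HasSum (fun j => ‖c j z‖ ^ 2) (V z) := fun z => by
    by_cases hz : z ∈ G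
    · exact (hVG z hz).summable.hasSum
    · have : (fun j => ‖c j z‖ ^ 2) = fun _ => 0 := funext fun j => by simp [hc0 j z hz]
      simp only [hVdef, this, tsum_zero]
      exact hasSum_zero
  have hVc : ContinuousOn V G := by
    have h1 := (hasSumLocallyUniformlyOn_iff_tendstoLocallyUniformlyOn.1 hsumG).continuousOn
      (Frequently.of_forall fun s => continuousOn_finsetSum _ fun j _ =>
        ((hψ j j.2).continuousOn.norm.pow 2))
    exact h1.congr fun z hz => (hVG z hz).tsum_eq
  have hne : ∃ j, ∃ z ∈ G, c j z ≠ 0 := by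
    obtain ⟨j, hj, z, hz, h⟩ := hψ_ne
    exact ⟨j, z, hz, by rwa [hcψ j hj z hz]⟩
  obtain ⟨hconv, F, hF, hFae⟩ :=
    exists_isGaussianAnalyticFunction hGo hGc hcm hc hc0 hV hVc hne hXm hXi hlaw
  have hpartial : ∀ᵐ ω ∂P, ∀ n, ∀ z ∈ G,
      gafPartialSum N ψ ξ n ω z = ∑ j ∈ Finset.range n, X j ω * c j z := by
    filter_upwards [hXξ] with ω hω n z hz
    rw [gafPartialSum, Finset.sum_filter]
    refine Finset.sum_congr rfl fun j _ => ?_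
    by_cases hj : (j : ℕ∞) < N
    · rw [if_pos hj, hω j hj, hcψ j hj z hz]
    · simp [hcdef, hj]
  -- Agreement on G suffices, since G is open and orders of vanishing are local.
  have hgaf : ∀ᵐ ω ∂P, Set.EqOn (F ω) (gaf N ψ ξ ω) G := by
    filter_upwards [hpartial, hFae] with ω h1 h2 z hz
    rw [h2, gaf]
    simp only [fun n => h1 n z hz]
  have hzeros : (fun ω => zeroMeasure G (F ω)) =ᵐ[P] gafZeros G N ψ ξ := by
    filter_upwards [hgaf] with ω hω
    exact zeroMeasure_congr hGo hω
  have hmean : meanMeasure P (gafZeros G N ψ ξ) = meanMeasure P fun ω => zeroMeasure G (F ω) :=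
    Measure.bind_congr_right hzeros.symm
  refine ⟨?_, ⟨_, measurable_zeroMeasure hGo hF.measurable hF.analytic hF.order_ne_top, hzeros.symm⟩,
    ?_, ?_, fun lam _ => ?_⟩
  · filter_upwards [hconv, hpartial] with ω h1 h2
    refine (h1.congr fun n z hz => (h2 n z hz).symm).congr_right fun z hz => ?_
    rw [gaf]
    simp only [fun n => h2 n z hz]
  · filter_upwards [hzeros] with ω hω
    rw [← hω]
    exact integrable_zeroMeasure hφ.continuous hφc hφG (hF.analytic ω) (hF.order_ne_top ω)
  · rw [hmean]
    exact hF.integrable_meanMeasure hφc hφG hφ.continuous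
  · rw [hmean]
    refine le_trans (le_of_eq (measureReal_congr ?_)) (hF.measureReal_le_norm_sub_le hφ hφc hφG lam)
    refine eventuallyEq_set.2 ?_
    filter_upwards [hzeros] with ω hω
    simp only [hω]
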